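/- Let $\mathcal G$ be a locally compact Hausdorff étale groupoid with unit space $\mathcal G^{(0)}$, source and range maps $s,r$, and fibres $\mathcal G_x=s^{-1}(x)$. Equip $C_c(\mathcal G)$ with the convolution product $(f*g)(\gamma)=\sum_{\alpha\in\mathcal G_{s(\gamma)}}f(\gamma\alpha^{-1})g(\alpha)$ and the involution $f^*(\gamma)=\overline{f(\gamma^{-1})}$. For $x\in\mathcal G^{(0)}$ let $\lambda_x:C_c(\mathcal G)\to B(\ell^2(\mathcal G_x))$, $(\lambda_x(f)\xi)(\gamma)=\sum_{\alpha\in\mathcal G_x}f(\gamma\alpha^{-1})\xi(\alpha)$, be the left regular representation, let $\|f\|_r=\sup_x\|\lambda_x(f)\|$ be the reduced norm, and let $C^*_r(\mathcal G)$ be the completion of $C_c(\mathcal G)$ in $\|\cdot\|_r$, to which each $\lambda_x$ extends. Let $E:C^*_r(\mathcal G)\to C_0(\mathcal G^{(0)})$, $E(a)(u)=\langle\lambda_u(a)\delta_u,\delta_u\rangle$, be the canonical conditional expectation. Let $\|\cdot\|_\nu$ be a $C^*$-norm on $C_c(\mathcal G)$ with $\|f\|_\nu\ge\|f\|_r$ for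 all $f\in C_c(\mathcal G)$, let $C^*_\nu(\mathcal G)$ be the corresponding completion, and let $q_\nu:C^*_\nu(\mathcal G)\to C^*_r(\mathcal G)$ be the canonical quotient map, i.e. the continuous extension of the identity of $C_c(\mathcal G)$. Let $\tau$ be a tracial state on $C^*_\nu(\mathcal G)$, and let $\mu$ be its associated measure, i.e. the probability Radon measure on $\mathcal G^{(0)}$ with $\tau(f)=\int_{\mathcal G^{(0)}}f\,d\mu$ for all $f\in C_c(\mathcal G^{(0)})$ (equivalently, for all $f\in C_0(\mathcal G^{(0)})$), where functions on $\mathcal G^{(0)}$ are extended by zero to $\mathcal G$. A bisection is a set $B\subseteq\mathcal G$ on which $s$ and $r$ restrict to homeomorphisms onto their images; put $\alpha_B=r\circ(s|_B)^{-1}:s(B)\to r(B)$ and $\mathrm{Fix}(\alpha_B)=\{x\in s(B):\alpha_B(x)=x\}$. Assume that $\mathcal G$ is essentially free with respect to $\mu$, i.e. $\mu(\mathrm{Fix}(\alpha_B))=0$ for every pre-compact open bisection $B\subseteq\mathcal G\setminus\mathcal G^{(0)}$. Then $\tau$ is canonical, i.e. $\tau(a)=\int_{\mathcal G^{(0)}}E(q_\nu(a))\,d\mu$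 for all $a\in C^*_\nu(\mathcal G)$. -/

import Mathlib

/-- A groupoid, presented by its set `G` of arrows: source and range take values in units (regarded
as arrows), and `mul a b` is the product of the composable pair `src a = rng b`. The values of `mul`
on non-composable pairs are irrelevant: they are constrained by no axiom. -/
class ArrowGroupoid (G : Type*) where
  src : G → G
  rng : G → G
  inv : G → G
  mul : G → G → G
  src_src : ∀ a, src (src a) = src a
  rng_src : ∀ a, rng (src a) = src a
  src_rng : ∀ a, src (rng a) = rng a
  rng_rng : ∀ a, rng (rng a) = rng a
  src_mul : ∀ a b, src a = rng b → src (mul a b) = src b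
  rng_mul : ∀ a b, src a = rng b → rng (mul a b) = rng a
  mul_assoc : ∀ a b c, src a = rng b → src b = rng c → mul (mul a b) c = mul a (mul b c)
  mul_src : ∀ a, mul a (src a) = a
  rng_mul_self : ∀ a, mul (rng a) a = a
  src_inv : ∀ a, src (inv a) = rng a
  rng_inv : ∀ a, rng (inv a) = src a
  inv_mul_self : ∀ a, mul (inv a) a = src a
  mul_inv_self : ∀ a, mul a (inv a) = rng a

namespace ArrowGroupoid

open Set Filter Topology Function CompactlySupported ZeroAtInfty ComplexConjugate ComplexOrder
  MeasureTheory

section Algebra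

variable {G : Type*} [ArrowGroupoid G]

variable (G) in
/-- The set of units `G⁽⁰⁾` of the groupoid. -/
def unitSet : Set G := {x | src x = x}

variable (G) in
/-- The unit space `G⁽⁰⁾` of the groupoid, with the topology induced from `G`. -/
abbrev UnitSpace : Type _ := unitSet G

/-- The source map `G → G⁽⁰⁾`. -/
def s (a : G) : UnitSpace G := ⟨src a, src_src a⟩

/-- The range map `G → G⁽⁰⁾`. -/
def r (a : G) : UnitSpace G := ⟨rng a, src_rng a⟩

/-- The source fibre `G_x = s⁻¹(x)`. -/
abbrev Fiber (x : UnitSpace G) : Type _ := {a : G // s a = x}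

/-- The element `a b⁻¹`, meaningful when `s(a) = s(b)`. -/
def div (a b : G) : G := mul a (inv b)

theorem s_eq_iff {a b : G} : s a = s b ↔ src a = src b := Subtype.mk_eq_mk

theorem r_eq_iff {a b : G} : r a = r b ↔ rng a = rng b := Subtype.mk_eq_mk

theorem s_eq_r_iff {a b : G} : s a = r b ↔ src a = rng b := Subtype.mk_eq_mk

theorem inv_inv (a : G) : inv (inv a) = a := by
  have h1 : mul (inv (inv a)) (mul (inv a) a) = inv (inv a) := by
    have := mul_src (inv (inv a))
    rwa [src_inv, rng_inv, ← inv_mul_self a] at this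
  rw [← h1, ← mul_assoc _ _ _ (by rw [src_inv]) (by rw [src_inv]), inv_mul_self, src_inv,
    rng_mul_self]

theorem s_inv (a : G) : s (inv a) = r a := Subtype.ext (src_inv a)

theorem r_inv (a : G) : r (inv a) = s a := Subtype.ext (rng_inv a)

theorem s_mul {a b : G} (h : s a = r b) : s (mul a b) = s b :=
  Subtype.ext (src_mul a b (s_eq_r_iff.1 h))

theorem r_mul {a b : G} (h : s a = r b) : r (mul a b) = r a :=
  Subtype.ext (rng_mul a b (s_eq_r_iff.1 h))

theorem mul_assoc' {a b c : G} (h : s a = r b) (h' : s b = r c) :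
    mul (mul a b) c = mul a (mul b c) :=
  mul_assoc _ _ _ (s_eq_r_iff.1 h) (s_eq_r_iff.1 h')

theorem s_div {a b : G} (h : s a = s b) : s (div a b) = r b := by
  rw [div, s_mul (by rw [h, r_inv]), s_inv]

theorem r_div {a b : G} (h : s a = s b) : r (div a b) = r a := by
  rw [div, r_mul (by rw [h, r_inv])]

theorem mul_inv_cancel_right' {a b : G} (h : s a = r b) : div (mul a b) b = a := by
  rw [div, mul_assoc' h (r_inv b).symm, mul_inv_self, ← s_eq_r_iff.1 h, mul_src]

theorem div_mul_cancel' {a b : G} (h : s a = s b) : mul (div a b) b = a := by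
  rw [div, mul_assoc' (by rw [h, r_inv]) (s_inv b), inv_mul_self, ← s_eq_iff.1 h, mul_src]

theorem inv_mul_cancel_left' {a b : G} (h : s a = r b) : mul (inv a) (mul a b) = b := by
  rw [← mul_assoc' (s_inv a) h, inv_mul_self, s_eq_r_iff.1 h, rng_mul_self]

theorem mul_inv_cancel_left' {a b : G} (h : r a = r b) : mul a (mul (inv a) b) = b := by
  rw [← mul_assoc' (r_inv a).symm (by rw [s_inv, h]), mul_inv_self, r_eq_iff.1 h, rng_mul_self]

theorem eq_inv_of_mul {a b : G} (h : s a = r b) (h' : mul a b = rng a) : b = inv a := by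
  have := inv_mul_cancel_left' h
  rw [h', ← src_inv, mul_src] at this
  exact this.symm

theorem inv_div {a b : G} (h : s a = s b) : inv (div a b) = div b a := by
  refine (eq_inv_of_mul ?_ ?_).symm
  · rw [s_div h, r_div h.symm]
  · have h1 : s (div a b) = r b := s_div h
    rw [div, div, mul_assoc' (by rw [h, r_inv]) (by rw [s_inv, r_mul (by rw [← h, r_inv])]),
      inv_mul_cancel_left' (by rw [← h, r_inv]), mul_inv_self, rng_mul]
    rw [rng_inv]; exact s_eq_iff.1 h

theorem div_div_div {a b c : G} (h : s a = s c) (h' : s b = s c) :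
    div (div a c) (div b c) = div a b := by
  rw [div, inv_div h', div, div, div, mul_assoc' (by rw [h, r_inv])
    (by rw [s_inv, r_mul (by rw [← h', r_inv])]), inv_mul_cancel_left' (by rw [← h', r_inv])]

theorem inv_unit {x : G} (hx : src x = x) : inv x = x := by
  have h : rng x = x := by rw [← hx, rng_src]
  have := mul_src (inv x)
  rw [src_inv, h] at this
  rw [← this, inv_mul_self, hx]

theorem s_unit (x : UnitSpace G) : s (x : G) = x := Subtype.ext x.2

theorem r_unit (x : UnitSpace G) : r (x : G) = x := Subtype.ext <| by
  change rng (x : G) = x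
  rw [← x.2, rng_src]

theorem div_unit {a : G} {x : UnitSpace G} (h : s a = x) : div a x = a := by
  subst h
  rw [div, inv_unit (by exact src_src a)]
  exact mul_src a

/-- Right translation by `a⁻¹`, as a bijection `G_{s(a)} ≃ G_{r(a)}`. -/
def rightDiv (a : G) : Fiber (s a) ≃ Fiber (r a) where
  toFun b := ⟨div b a, s_div b.2⟩
  invFun b := ⟨mul b a, s_mul b.2⟩
  left_inv b := Subtype.ext (div_mul_cancel' b.2)
  right_inv b := Subtype.ext (mul_inv_cancel_right' b.2)

/-- A function which is finitely supported on every range fibre. -/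
def RFinite (f : G → ℂ) : Prop := ∀ x : UnitSpace G, {a | r a = x ∧ f a ≠ 0}.Finite

/-- A function which is finitely supported on every source fibre. -/
def SFinite (f : G → ℂ) : Prop := ∀ x : UnitSpace G, {a | s a = x ∧ f a ≠ 0}.Finite

/-- The operator `(λ_x(f) ξ)(γ) = ∑_{α ∈ G_x} f(γ α⁻¹) ξ(α)`, for arbitrary functions `ξ` on the
source fibre `G_x`. -/
noncomputable def fiberOp (f : G → ℂ) (x : UnitSpace G) (ξ : Fiber x → ℂ) (c : Fiber x) : ℂ :=
  ∑ᶠ a : Fiber x, f (div c a) * ξ a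

/-- The convolution `(f * g)(γ) = ∑_{α ∈ G_{s(γ)}} f(γ α⁻¹) g(α)`. -/
noncomputable def conv (f g : G → ℂ) (c : G) : ℂ :=
  ∑ᶠ a : Fiber (s c), f (div c a) * g a

theorem conv_eq_fiberOp (f g : G → ℂ) {x : UnitSpace G} (c : Fiber x) :
    conv f g c = fiberOp f x (fun a => g a) c := by
  obtain ⟨c, rfl⟩ := c
  rfl

theorem RFinite.finite_div {f : G → ℂ} (hf : RFinite f) {x : UnitSpace G} (c : Fiber x) :
    {a : Fiber x | f (div c a) ≠ 0}.Finite := by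
  refine Set.Finite.of_finite_image (f := fun a : Fiber x => div (c : G) a) ?_ ?_
  · refine (hf (r (c : G))).subset ?_
    rintro _ ⟨a, ha, rfl⟩
    exact ⟨r_div (c.2.trans a.2.symm), ha⟩
  · intro a _ b _ hab
    have ha : s (c : G) = s (a : G) := c.2.trans a.2.symm
    have hb : s (c : G) = s (b : G) := c.2.trans b.2.symm
    have : inv (div (c : G) a) = inv (div (c : G) b) := by simp only at hab; rw [hab]
    rw [inv_div ha, inv_div hb] at this
    refine Subtype.ext ?_
    rw [← div_mul_cancel' ha.symm, this, div_mul_cancel' hb.symm]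

theorem SFinite.finite_div {f : G → ℂ} (hf : SFinite f) {x : UnitSpace G} (c : Fiber x) :
    {a : Fiber x | f (div a c) ≠ 0}.Finite := by
  refine Set.Finite.of_finite_image (f := fun a : Fiber x => div (a : G) c) ?_ ?_
  · refine (hf (r (c : G))).subset ?_
    rintro _ ⟨a, ha, rfl⟩
    exact ⟨s_div (a.2.trans c.2.symm), ha⟩
  · intro a _ b _ hab
    have ha : s (a : G) = s (c : G) := a.2.trans c.2.symm
    have hb : s (b : G) = s (c : G) := b.2.trans c.2.symm
    refine Subtype.ext ?_
    simp only at hab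
    rw [← div_mul_cancel' ha, hab, div_mul_cancel' hb]

theorem conv_div (f g : G → ℂ) {x : UnitSpace G} (c a : Fiber x) :
    conv f g (div c a) = ∑ᶠ d : Fiber x, f (div c d) * g (div d a) := by
  obtain ⟨a, rfl⟩ := a
  have h : s (div (c : G) a) = r a := s_div c.2
  rw [conv_eq_fiberOp f g (⟨div c a, h⟩ : Fiber (r a)), fiberOp, ← finsum_comp_equiv (rightDiv a)]
  refine finsum_congr fun d => ?_
  simp only [rightDiv, Equiv.coe_fn_mk]
  rw [div_div_div c.2 d.2]

theorem fiberOp_conv {f g : G → ℂ} (hf : RFinite f) (hg : RFinite g) (x : UnitSpace G)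
    (ξ : Fiber x → ℂ) : fiberOp (conv f g) x ξ = fiberOp f x (fiberOp g x ξ) := by
  funext c
  have hD := hf.finite_div c
  have e1 : ∀ h : Fiber x → ℂ, (∑ᶠ d : Fiber x, f (div c d) * h d) =
      ∑ d ∈ hD.toFinset, f (div c d) * h d := fun h =>
    finsum_eq_sum_of_support_subset _ fun d hd => by
      simp only [Finite.coe_toFinset, Set.mem_ofPred_eq]
      exact left_ne_zero_of_mul hd
  have hl : fiberOp (conv f g) x ξ c =
      ∑ᶠ a : Fiber x, ∑ d ∈ hD.toFinset, f (div c d) * (g (div d a) * ξ a) := by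
    refine finsum_congr fun a => ?_
    rw [conv_div, e1, Finset.sum_mul]
    simp only [_root_.mul_assoc]
  rw [hl, finsum_sum_comm]
  · rw [fiberOp, e1]
    refine Finset.sum_congr rfl fun d _ => ?_
    rw [fiberOp, mul_finsum]
  · intro d _
    refine (hg.finite_div d).subset fun a ha => ?_
    exact left_ne_zero_of_mul (right_ne_zero_of_mul ha)

theorem conv_assoc {f g : G → ℂ} (hf : RFinite f) (hg : RFinite g) (h : G → ℂ) :
    conv (conv f g) h = conv f (conv g h) := by
  funext c
  have := congrFun (fiberOp_conv hf hg (s c) (fun a => h a)) ⟨c, rfl⟩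
  refine this.trans ?_
  refine finsum_congr fun a => ?_
  simp only
  rw [conv_eq_fiberOp g h a]

theorem finite_fiberOp {f : G → ℂ} (hf : RFinite f) {x : UnitSpace G} (ξ : Fiber x → ℂ)
    (c : Fiber x) : HasFiniteSupport fun a : Fiber x => f (div c a) * ξ a :=
  (hf.finite_div c).subset fun _ ha => left_ne_zero_of_mul ha

theorem fiberOp_add_right {f : G → ℂ} (hf : RFinite f) {x : UnitSpace G} (ξ η : Fiber x → ℂ) :
    fiberOp f x (ξ + η) = fiberOp f x ξ + fiberOp f x η := by
  funext c
  simp only [fiberOp, Pi.add_apply, mul_add]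
  exact finsum_add_distrib (finite_fiberOp hf ξ c) (finite_fiberOp hf η c)

theorem fiberOp_add_left {f g : G → ℂ} (hf : RFinite f) (hg : RFinite g) {x : UnitSpace G}
    (ξ : Fiber x → ℂ) : fiberOp (f + g) x ξ = fiberOp f x ξ + fiberOp g x ξ := by
  funext c
  simp only [fiberOp, Pi.add_apply, add_mul]
  exact finsum_add_distrib (finite_fiberOp hf ξ c) (finite_fiberOp hg ξ c)

theorem fiberOp_smul_right (k : ℂ) (f : G → ℂ) {x : UnitSpace G} (ξ : Fiber x → ℂ) :
    fiberOp f x (k • ξ) = k • fiberOp f x ξ := by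
  funext c
  simp only [fiberOp, Pi.smul_apply, smul_eq_mul, mul_finsum]
  exact finsum_congr fun a => by ring

theorem fiberOp_smul_left (k : ℂ) (f : G → ℂ) {x : UnitSpace G} (ξ : Fiber x → ℂ) :
    fiberOp (k • f) x ξ = k • fiberOp f x ξ := by
  funext c
  simp only [fiberOp, Pi.smul_apply, smul_eq_mul, mul_finsum]
  exact finsum_congr fun a => by ring

theorem conv_add_right {f : G → ℂ} (hf : RFinite f) (g h : G → ℂ) :
    conv f (g + h) = conv f g + conv f h := by
  funext c
  exact congrFun (fiberOp_add_right hf (fun a : Fiber (s c) => g a) (fun a => h a)) ⟨c, rfl⟩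

theorem conv_add_left {f g : G → ℂ} (hf : RFinite f) (hg : RFinite g) (h : G → ℂ) :
    conv (f + g) h = conv f h + conv g h := by
  funext c
  exact congrFun (fiberOp_add_left hf hg (fun a : Fiber (s c) => h a)) ⟨c, rfl⟩

theorem conv_smul_right (k : ℂ) (f g : G → ℂ) : conv f (k • g) = k • conv f g := by
  funext c
  exact congrFun (fiberOp_smul_right k f (fun a : Fiber (s c) => g a)) ⟨c, rfl⟩

theorem conv_smul_left (k : ℂ) (f g : G → ℂ) : conv (k • f) g = k • conv f g := by
  funext c
  exact congrFun (fiberOp_smul_left k f (fun a : Fiber (s c) => g a)) ⟨c, rfl⟩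

theorem conv_sum_right {ι : Type*} {f : G → ℂ} (hf : RFinite f) (t : Finset ι) (g : ι → G → ℂ) :
    conv f (∑ i ∈ t, g i) = ∑ i ∈ t, conv f (g i) := by
  classical
  induction t using Finset.induction_on with
  | empty =>
    funext c
    simp [conv]
  | insert i t hi ih => rw [Finset.sum_insert hi, Finset.sum_insert hi, conv_add_right hf, ih]

/-- The involution `f*(γ) = conj (f (γ⁻¹))`. -/
noncomputable def involution (f : G → ℂ) (c : G) : ℂ := conj (f (inv c))

theorem involution_conv (f g : G → ℂ) :
    involution (conv f g) = conv (involution g) (involution f) := by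
  funext c
  have h : s (inv c) = r c := s_inv c
  simp only [involution]
  rw [conv_eq_fiberOp f g (⟨inv c, h⟩ : Fiber (r c)), fiberOp, ← finsum_comp_equiv (rightDiv c),
    conv]
  have hmap : ∀ F : Fiber (s c) → ℂ, conj (∑ᶠ a, F a) = ∑ᶠ a, conj (F a) := fun F =>
    AddMonoidHom.map_finsum_of_injective ((starRingEnd ℂ : ℂ →+* ℂ) : ℂ →+ ℂ)
      (star_injective) F
  rw [hmap]
  refine finsum_congr fun a => ?_
  have ha : s (a : G) = s c := a.2
  have e : div (inv c) (div (a : G) c) = inv (a : G) := by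
    rw [div, inv_div ha, div, inv_mul_cancel_left' (by rw [r_inv, ha])]
  simp only [rightDiv, Equiv.coe_fn_mk, map_mul, e, involution, inv_div ha.symm]
  ring

end Algebra

/-- A topological groupoid which is étale: the operations are continuous for the induced topologies
and the range map is a local homeomorphism onto the unit space. Local compactness and the Hausdorff
property are separate assumptions. -/
class IsEtaleGroupoid (G : Type*) [TopologicalSpace G] [ArrowGroupoid G] : Prop where
  continuous_src : Continuous (src : G → G)
  continuous_rng : Continuous (rng : G → G)
  continuous_inv : Continuous (inv : G → G)
  continuousOn_mul : ContinuousOn (fun p : G × G => mul p.1 p.2) {p | src p.1 = rng p.2}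
  isLocalHomeomorph_r : IsLocalHomeomorph (r : G → UnitSpace G)

section LocalHomeo

variable {X Y : Type*} [TopologicalSpace X] [TopologicalSpace Y]

theorem exists_card_le_of_isCompact {p : X → Y} (hp : IsLocalHomeomorph p) {K : Set X}
    (hK : IsCompact K) : ∃ n : ℕ, ∀ (y : Y) (F : Finset X), (∀ a ∈ F, a ∈ K ∧ p a = y) →
      F.card ≤ n := by
  classical
  refine hK.induction_on (p := fun K : Set X => ∃ n : ℕ, ∀ (y : Y) (F : Finset X),
    (∀ a ∈ F, a ∈ K ∧ p a = y) → F.card ≤ n) ?_ ?_ ?_ ?_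
  · refine ⟨0, fun y F h => ?_⟩
    rw [Nat.le_zero, Finset.card_eq_zero]
    exact Finset.eq_empty_of_forall_notMem fun a ha => (h a ha).1
  · rintro S T hST ⟨n, hn⟩
    exact ⟨n, fun y F h => hn y F fun a ha => ⟨hST (h a ha).1, (h a ha).2⟩⟩
  · rintro S T ⟨n, hn⟩ ⟨m, hm⟩
    refine ⟨n + m, fun y F h => ?_⟩
    rw [← Finset.card_filter_add_card_filter_not (s := F) (fun a => a ∈ S)]
    refine add_le_add (hn y _ fun a ha => ?_) (hm y _ fun a ha => ?_)
    · rw [Finset.mem_filter] at ha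
      exact ⟨ha.2, (h a ha.1).2⟩
    · rw [Finset.mem_filter] at ha
      exact ⟨(h a ha.1).1.resolve_left ha.2, (h a ha.1).2⟩
  · intro x _
    obtain ⟨e, hx, rfl⟩ := hp x
    refine ⟨e.source, mem_nhdsWithin_of_mem_nhds (e.open_source.mem_nhds hx), 1, fun y F h => ?_⟩
    rw [Finset.card_le_one]
    intro a ha b hb
    exact e.injOn (h a ha).1 (h b hb).1 ((h a ha).2.trans (h b hb).2.symm)

theorem finite_fiber_of_isCompact {p : X → Y} (hp : IsLocalHomeomorph p) {K : Set X}
    (hK : IsCompact K) (y : Y) : {a | p a = y ∧ a ∈ K}.Finite := by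
  obtain ⟨n, hn⟩ := exists_card_le_of_isCompact hp hK
  by_contra h
  obtain ⟨F, hF, hc⟩ := Set.Infinite.exists_subset_card_eq h (n + 1)
  have := hn y F fun a ha => ⟨(hF ha).2, (hF ha).1⟩
  omega

theorem exists_sum_norm_le {p : X → Y} (hp : IsLocalHomeomorph p) (f : C_c(X, ℂ)) :
    ∃ C : ℝ, 0 ≤ C ∧ ∀ (y : Y) (F : Finset X), (∀ a ∈ F, p a = y) → ∑ a ∈ F, ‖f a‖ ≤ C := by
  classical
  obtain ⟨n, hn⟩ := exists_card_le_of_isCompact hp f.hasCompactSupport.isCompact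
  obtain ⟨M, hM⟩ := f.hasCompactSupport.exists_bound_of_continuous f.continuous
  refine ⟨n * |M|, by positivity, fun y F h => ?_⟩
  have h1 : ∑ a ∈ F.filter (fun a => f a ≠ 0), ‖f a‖ = ∑ a ∈ F, ‖f a‖ := by
    refine Finset.sum_filter_of_ne fun a _ ha => ?_
    exact fun h0 => ha (by rw [h0, norm_zero])
  rw [← h1]
  calc ∑ a ∈ F.filter (fun a => f a ≠ 0), ‖f a‖
      ≤ (F.filter (fun a => f a ≠ 0)).card • |M| :=
        Finset.sum_le_card_nsmul _ _ _ fun a _ => (hM a).trans (le_abs_self M)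
    _ ≤ n * |M| := by
        rw [nsmul_eq_mul]
        gcongr
        refine hn y _ fun a ha => ?_
        rw [Finset.mem_filter] at ha
        exact ⟨subset_tsupport _ ha.2, h a ha.1⟩

end LocalHomeo

section Convolution

variable {G : Type*} [TopologicalSpace G] [ArrowGroupoid G] [IsEtaleGroupoid G]

open IsEtaleGroupoid

theorem continuous_s : Continuous (s : G → UnitSpace G) := continuous_src.subtype_mk _

theorem continuous_r : Continuous (r : G → UnitSpace G) := continuous_rng.subtype_mk _

variable (G) in
/-- Inversion as a homeomorphism. -/
def invHomeo : G ≃ₜ G where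
  toFun := inv
  invFun := inv
  left_inv := inv_inv
  right_inv := inv_inv
  continuous_toFun := continuous_inv
  continuous_invFun := continuous_inv

theorem isLocalHomeomorph_s : IsLocalHomeomorph (s : G → UnitSpace G) := by
  have h : (s : G → UnitSpace G) = r ∘ invHomeo G := by
    funext a
    exact (r_inv a).symm
  rw [h]
  exact isLocalHomeomorph_r.comp (invHomeo G).isLocalHomeomorph

theorem isOpen_unitSet : IsOpen (unitSet G) := by
  rw [isOpen_iff_mem_nhds]
  intro x hx
  obtain ⟨e, hxe, he⟩ := (IsEtaleGroupoid.isLocalHomeomorph_r (G := G)) x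
  have hrx : rng x = x := by rw [← (show src x = x from hx), rng_src]
  have h1 : rng ⁻¹' e.source ∈ 𝓝 x :=
    IsEtaleGroupoid.continuous_rng.continuousAt.preimage_mem_nhds
      (by rw [hrx]; exact e.open_source.mem_nhds hxe)
  filter_upwards [e.open_source.mem_nhds hxe, h1] with a ha ha'
  have h2 : rng a = a := by
    refine e.injOn ha' ha ?_
    rw [← he]
    exact Subtype.ext (rng_rng a)
  change src a = a
  rw [← h2, src_rng]

theorem rFinite (f : C_c(G, ℂ)) : RFinite (f : G → ℂ) := fun x =>
  (finite_fiber_of_isCompact isLocalHomeomorph_r f.hasCompactSupport.isCompact x).subset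
    fun _ ha => ⟨ha.1, subset_tsupport _ ha.2⟩

theorem sFinite (f : C_c(G, ℂ)) : SFinite (f : G → ℂ) := fun x =>
  (finite_fiber_of_isCompact isLocalHomeomorph_s f.hasCompactSupport.isCompact x).subset
    fun _ ha => ⟨ha.1, subset_tsupport _ ha.2⟩

variable [T2Space G]

theorem isClosed_unitSet : IsClosed (unitSet G) :=
  isClosed_eq IsEtaleGroupoid.continuous_src continuous_id

theorem continuous_conv_of_tsupport_subset {f g : G → ℂ} (hf : Continuous f) (hg : Continuous g)
    (hgc : HasCompactSupport g) (e : OpenPartialHomeomorph G (UnitSpace G))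
    (he : (s : G → UnitSpace G) = e) (hge : tsupport g ⊆ e.source) : Continuous (conv f g) := by
  rw [continuous_iff_continuousAt]
  intro c₀
  by_cases hc₀ : s c₀ ∈ e.target
  · have hO : IsOpen ((s : G → UnitSpace G) ⁻¹' e.target) := e.open_target.preimage continuous_s
    have hs : ∀ c : G, s c ∈ e.target → s (e.symm (s c)) = s c := fun c hc => by
      have := e.right_inv hc
      rwa [← he] at this
    have heq : ∀ c ∈ (s : G → UnitSpace G) ⁻¹' e.target,
        conv f g c = f (mul c (inv (e.symm (s c)))) * g (e.symm (s c)) := by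
      intro c hc
      refine finsum_eq_single (fun a : Fiber (s c) => f (div c a) * g a)
        ⟨e.symm (s c), hs c hc⟩ fun a ha => ?_
      have : g a = 0 := by
        by_contra h0
        refine ha (Subtype.ext ?_)
        have h1 : (a : G) ∈ e.source := hge (subset_tsupport _ h0)
        have h2 : e (a : G) = s c := by rw [← he]; exact a.2
        exact (e.left_inv h1).symm.trans (congrArg e.symm h2)
      rw [this, mul_zero]
    have hsymm : ContinuousOn (fun c : G => e.symm (s c)) (s ⁻¹' e.target) :=
      e.continuousOn_symm.comp continuous_s.continuousOn fun _ h => h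
    have hmul : ContinuousOn (fun c : G => mul c (inv (e.symm (s c)))) (s ⁻¹' e.target) := by
      refine ContinuousOn.comp (g := fun p : G × G => mul p.1 p.2)
        (f := fun c : G => (c, inv (e.symm (s c)))) continuousOn_mul
        (continuousOn_id.prodMk (continuous_inv.comp_continuousOn hsymm)) ?_
      intro c hc
      change src c = rng (inv (e.symm (s c)))
      rw [rng_inv, ← s_eq_iff, hs c hc]
    have hcont : ContinuousOn (conv f g) (s ⁻¹' e.target) :=
      ((hf.comp_continuousOn hmul).mul (hg.comp_continuousOn hsymm)).congr heq
    exact hcont.continuousAt (hO.mem_nhds hc₀)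
  · have hcl : IsClosed ((s : G → UnitSpace G) ⁻¹' (s '' tsupport g)) :=
      (hgc.isCompact.image continuous_s).isClosed.preimage continuous_s
    have hmem : c₀ ∈ ((s : G → UnitSpace G) ⁻¹' (s '' tsupport g))ᶜ := by
      rintro ⟨a, ha, hac⟩
      refine hc₀ ?_
      rw [← hac, he]
      exact e.map_source (hge ha)
    have hz : ∀ᶠ c in 𝓝 c₀, (0 : ℂ) = conv f g c := by
      filter_upwards [hcl.isOpen_compl.mem_nhds hmem] with c hc
      symm
      refine (finsum_congr fun a => ?_).trans finsum_zero
      have : g a = 0 := by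
        by_contra h0
        exact hc ⟨a, subset_tsupport _ h0, a.2⟩
      rw [this, mul_zero]
    exact continuousAt_const.congr hz

theorem continuous_conv [LocallyCompactSpace G] (f g : C_c(G, ℂ)) :
    Continuous (conv (f : G → ℂ) g) := by
  have hs := isLocalHomeomorph_s (G := G)
  choose e hxe he using fun x : G => hs x
  obtain ⟨t, -, ht⟩ := g.hasCompactSupport.isCompact.elim_nhds_subcover
    (fun x => (e x).source) fun x _ => (e x).open_source.mem_nhds (hxe x)
  let q : Fin t.card → G := fun i => t.equivFin.symm i
  have hcov : tsupport (g : G → ℂ) ⊆ ⋃ i, (e (q i)).source := by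
    intro a ha
    obtain ⟨x, hx, hax⟩ := mem_iUnion₂.1 (ht ha)
    refine mem_iUnion.2 ⟨t.equivFin ⟨x, hx⟩, ?_⟩
    simpa [q] using hax
  obtain ⟨φ, hφs, hφ1, -, hφc⟩ := exists_continuous_sum_one_of_isOpen_isCompact
    (fun i => (e (q i)).open_source) g.hasCompactSupport.isCompact hcov
  have hg : (g : G → ℂ) = ∑ i, fun a => (φ i a : ℂ) * g a := by
    funext a
    rw [Finset.sum_apply, ← Finset.sum_mul]
    by_cases ha : a ∈ tsupport (g : G → ℂ)
    · have := hφ1 ha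
      simp only [Finset.sum_apply, Pi.one_apply] at this
      rw [← Complex.ofReal_sum, this, Complex.ofReal_one, one_mul]
    · rw [image_eq_zero_of_notMem_tsupport ha, mul_zero]
  rw [hg, conv_sum_right (rFinite f)]
  have hsub : ∀ i, tsupport (fun a => (φ i a : ℂ) * g a) ⊆ tsupport (φ i) := fun i =>
    closure_mono fun a ha h0 => ha (by simp [h0])
  have := fun i => continuous_conv_of_tsupport_subset f.continuous
    (g := fun a => (φ i a : ℂ) * g a)
    ((Complex.continuous_ofReal.comp (φ i).continuous).mul g.continuous)
    ((hφc i).of_isClosed_subset (isClosed_tsupport _) (hsub i))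
    (e (q i)) (he (q i)) ((hsub i).trans (hφs i))
  have h2 : (∑ i, conv (f : G → ℂ) (fun a => (φ i a : ℂ) * g a)) =
      fun c => ∑ i, conv (f : G → ℂ) (fun a => (φ i a : ℂ) * g a) c := by
    funext c
    rw [Finset.sum_apply]
  rw [h2]
  exact continuous_finsetSum _ fun i _ => this i

theorem hasCompactSupport_conv (f g : C_c(G, ℂ)) : HasCompactSupport (conv (f : G → ℂ) g) := by
  have hcl : IsClosed {p : G × G | src p.1 = rng p.2} :=
    isClosed_eq (continuous_src.comp continuous_fst) (continuous_rng.comp continuous_snd)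
  have hK := (f.hasCompactSupport.isCompact.prod g.hasCompactSupport.isCompact).inter_right hcl
  refine HasCompactSupport.of_support_subset_isCompact
    (hK.image_of_continuousOn (continuousOn_mul.mono inter_subset_right)) ?_
  intro c hc
  obtain ⟨a, ha⟩ : ∃ a : Fiber (s c), f (div c a) * g a ≠ 0 := by
    by_contra h
    push Not at h
    exact hc ((finsum_congr h).trans finsum_zero)
  refine ⟨(div c a, a), ⟨⟨subset_tsupport _ (left_ne_zero_of_mul ha),
    subset_tsupport _ (right_ne_zero_of_mul ha)⟩, ?_⟩, div_mul_cancel' a.2.symm⟩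
  exact s_eq_r_iff.1 (s_div a.2.symm)

end Convolution

section ConvAlg

variable (G : Type*) [TopologicalSpace G]

/-- The convolution `*`-algebra `C_c(G)` of an étale groupoid: as a vector space this is `C_c(G, ℂ)`;
the product is convolution and the involution is `f*(γ) = conj (f (γ⁻¹))`. -/
def ConvAlg : Type _ := C_c(G, ℂ)

noncomputable instance : AddCommGroup (ConvAlg G) := inferInstanceAs (AddCommGroup C_c(G, ℂ))

noncomputable instance : Module ℂ (ConvAlg G) := inferInstanceAs (Module ℂ C_c(G, ℂ))

instance : FunLike (ConvAlg G) G ℂ := inferInstanceAs (FunLike C_c(G, ℂ) G ℂ)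

variable {G}

@[ext]
theorem ConvAlg.ext {f g : ConvAlg G} (h : ∀ a, f a = g a) : f = g := DFunLike.ext _ _ h

theorem ConvAlg.coe_add (f g : ConvAlg G) : ⇑(f + g) = ⇑f + ⇑g := rfl

theorem ConvAlg.coe_smul (k : ℂ) (f : ConvAlg G) : ⇑(k • f) = k • ⇑f := rfl

theorem ConvAlg.coe_zero : ⇑(0 : ConvAlg G) = 0 := rfl

theorem ConvAlg.coe_neg (f : ConvAlg G) : ⇑(-f) = -⇑f := rfl

variable [ArrowGroupoid G] [IsEtaleGroupoid G]

theorem ConvAlg.rFinite (f : ConvAlg G) : RFinite (f : G → ℂ) :=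
  ArrowGroupoid.rFinite (show C_c(G, ℂ) from f)

theorem ConvAlg.sFinite (f : ConvAlg G) : SFinite (f : G → ℂ) :=
  ArrowGroupoid.sFinite (show C_c(G, ℂ) from f)

noncomputable instance : Star (ConvAlg G) where
  star f :=
    let f' : C_c(G, ℂ) := f
    (⟨⟨involution f', Complex.continuous_conj.comp
        (f'.continuous.comp IsEtaleGroupoid.continuous_inv)⟩,
      (f'.hasCompactSupport.comp_homeomorph (invHomeo G)).comp_left
        (g := fun z : ℂ => conj z) (map_zero _)⟩ : C_c(G, ℂ))

theorem ConvAlg.coe_star (f : ConvAlg G) : ⇑(star f) = involution f := rfl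

variable [T2Space G] [LocallyCompactSpace G]

noncomputable instance : Mul (ConvAlg G) where
  mul f g :=
    let f' : C_c(G, ℂ) := f
    let g' : C_c(G, ℂ) := g
    (⟨⟨conv f' g', continuous_conv f' g'⟩, hasCompactSupport_conv f' g'⟩ : C_c(G, ℂ))

theorem ConvAlg.coe_mul (f g : ConvAlg G) : ⇑(f * g) = conv f g := rfl

noncomputable instance : NonUnitalRing (ConvAlg G) where
  left_distrib f g h := DFunLike.coe_injective (conv_add_right f.rFinite g h)
  right_distrib f g h := DFunLike.coe_injective (conv_add_left f.rFinite g.rFinite h)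
  zero_mul f := DFunLike.coe_injective <| by
    funext c
    simp [ConvAlg.coe_mul, conv, ConvAlg.coe_zero]
  mul_zero f := DFunLike.coe_injective <| by
    funext c
    simp [ConvAlg.coe_mul, conv, ConvAlg.coe_zero]
  mul_assoc f g h := DFunLike.coe_injective (conv_assoc f.rFinite g.rFinite h)

noncomputable instance : StarRing (ConvAlg G) where
  star_involutive f := DFunLike.coe_injective <| by
    funext c
    simp [ConvAlg.coe_star, involution, inv_inv]
  star_mul f g := DFunLike.coe_injective (involution_conv f g)
  star_add f g := DFunLike.coe_injective <| by
    funext c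
    simp [ConvAlg.coe_star, involution, ConvAlg.coe_add]

noncomputable instance : IsScalarTower ℂ (ConvAlg G) (ConvAlg G) where
  smul_assoc k f g := DFunLike.coe_injective (conv_smul_left k f g)

noncomputable instance : SMulCommClass ℂ (ConvAlg G) (ConvAlg G) where
  smul_comm k f g := DFunLike.coe_injective (conv_smul_right k f g).symm

noncomputable instance : StarModule ℂ (ConvAlg G) where
  star_smul k f := DFunLike.coe_injective <| by
    funext c
    simp [ConvAlg.coe_star, involution, ConvAlg.coe_smul]

end ConvAlg

section Completion

/-- A C⋆-norm on a complex `*`-algebra `A`: a submultiplicative norm with `‖f* f‖ = ‖f‖²`. -/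
structure CStarNorm (A : Type*) [NonUnitalRing A] [StarRing A] [Module ℂ A] extends RingNorm A where
  smul' : ∀ (k : ℂ) (f : A), toFun (k • f) = ‖k‖ * toFun f
  star_mul_self' : ∀ f : A, toFun (star f * f) = toFun f * toFun f

namespace CStarNorm

variable {A : Type*} [NonUnitalRing A] [StarRing A] [Module ℂ A]

instance : CoeFun (CStarNorm A) fun _ => A → ℝ := ⟨fun ν => ν.toFun⟩

/-- The `*`-algebra `A`, normed by the C⋆-norm `ν`. -/
def Normed (_ : CStarNorm A) : Type _ := A

variable (ν : CStarNorm A)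

noncomputable instance : NonUnitalNormedRing ν.Normed :=
  { (inferInstance : NonUnitalRing A),
    (ν.toRingNorm.toAddGroupNorm.toNormedAddCommGroup : NormedAddCommGroup A) with
    norm_mul_le := ν.mul_le' }

noncomputable instance : StarRing ν.Normed := inferInstanceAs (StarRing A)

noncomputable instance : CStarRing ν.Normed where
  norm_mul_self_le f := (ν.star_mul_self' f).ge

noncomputable instance : NormedSpace ℂ ν.Normed :=
  { (inferInstance : Module ℂ A) with
    norm_smul_le := fun k f => (ν.smul' k f).le }

noncomputable instance [IsScalarTower ℂ A A] : IsScalarTower ℂ ν.Normed ν.Normed :=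
  inferInstanceAs (IsScalarTower ℂ A A)

noncomputable instance [SMulCommClass ℂ A A] : SMulCommClass ℂ ν.Normed ν.Normed :=
  inferInstanceAs (SMulCommClass ℂ A A)

noncomputable instance [StarModule ℂ A] : StarModule ℂ ν.Normed :=
  inferInstanceAs (StarModule ℂ A)

/-- The C⋆-completion of `A` with respect to the C⋆-norm `ν`. -/
def Completion : Type _ := UniformSpace.Completion ν.Normed

noncomputable instance : NormedAddCommGroup ν.Completion :=
  inferInstanceAs (NormedAddCommGroup (UniformSpace.Completion ν.Normed))

noncomputable instance : NormedSpace ℂ ν.Completion :=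
  inferInstanceAs (NormedSpace ℂ (UniformSpace.Completion ν.Normed))

instance : CompleteSpace ν.Completion :=
  inferInstanceAs (CompleteSpace (UniformSpace.Completion ν.Normed))

/-- The canonical linear inclusion of `A` in its C⋆-completion. -/
noncomputable def ι : A →ₗ[ℂ] ν.Completion :=
  ((UniformSpace.Completion.toComplₗᵢ : ν.Normed →ₗᵢ[ℂ] UniformSpace.Completion ν.Normed) :
    ν.Normed →ₗ[ℂ] UniformSpace.Completion ν.Normed)

theorem norm_ι (f : A) : ‖ν.ι f‖ = ν f :=
  UniformSpace.Completion.norm_coe (E := ν.Normed) f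

theorem denseRange_ι : DenseRange ν.ι :=
  UniformSpace.Completion.denseRange_coe (α := ν.Normed)

theorem isDenseInducing_ι : IsDenseInducing (fun f : ν.Normed => ν.ι f) :=
  UniformSpace.Completion.isDenseInducing_coe (α := ν.Normed)

theorem continuous_ι : Continuous (fun f : ν.Normed => ν.ι f) := ν.isDenseInducing_ι.continuous

noncomputable instance : Mul ν.Completion where
  mul := curry <| (ν.isDenseInducing_ι.prodMap ν.isDenseInducing_ι).extend
    fun p => ν.ι (p.1 * p.2 : ν.Normed)

theorem ι_mul (f g : A) : ν.ι (f * g) = ν.ι f * ν.ι g :=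
  ((ν.isDenseInducing_ι.prodMap ν.isDenseInducing_ι).extend_eq
    (f := fun p : ν.Normed × ν.Normed => ν.ι (p.1 * p.2 : ν.Normed))
    (ν.continuous_ι.comp continuous_mul) (f, g)).symm

instance : ContinuousMul ν.Completion where
  continuous_mul := by
    let e : ν.Normed →+ ν.Completion := (ν.ι : A →+ ν.Completion)
    let m := (AddMonoidHom.mul : ν.Normed →+ ν.Normed →+ ν.Normed).compr₂ e
    have : Continuous fun p : ν.Normed × ν.Normed => m p.1 p.2 :=
      ν.continuous_ι.comp continuous_mul
    have di : IsDenseInducing e := ν.isDenseInducing_ι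
    exact (di.extend_Z_bilin di this :)

theorem induction_on {p : ν.Completion → Prop} (a : ν.Completion) (hp : IsClosed {a | p a})
    (h : ∀ f : A, p (ν.ι f)) : p a :=
  UniformSpace.Completion.induction_on (α := ν.Normed) a hp h

theorem induction_on₂ {p : ν.Completion → ν.Completion → Prop} (a b : ν.Completion)
    (hp : IsClosed {x : ν.Completion × ν.Completion | p x.1 x.2})
    (h : ∀ f g : A, p (ν.ι f) (ν.ι g)) : p a b :=
  UniformSpace.Completion.induction_on₂ (α := ν.Normed) (β := ν.Normed) a b hp h

theorem induction_on₃ {p : ν.Completion → ν.Completion → ν.Completion → Prop}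
    (a b c : ν.Completion)
    (hp : IsClosed {x : ν.Completion × ν.Completion × ν.Completion | p x.1 x.2.1 x.2.2})
    (h : ∀ f g k : A, p (ν.ι f) (ν.ι g) (ν.ι k)) : p a b c :=
  UniformSpace.Completion.induction_on₃ (α := ν.Normed) (β := ν.Normed) (γ := ν.Normed) a b c hp h

noncomputable instance : NonUnitalNormedRing ν.Completion where
  __ := (inferInstance : NormedAddCommGroup ν.Completion)
  left_distrib a b c := ν.induction_on₃ (p := fun a b c => a * (b + c) = a * b + a * c) a b c
    (isClosed_eq (by fun_prop) (by fun_prop))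
    fun f g k => by rw [← map_add, ← ι_mul, ← ι_mul, ← ι_mul, ← map_add, mul_add]
  right_distrib a b c := ν.induction_on₃ (p := fun a b c => (a + b) * c = a * c + b * c) a b c
    (isClosed_eq (by fun_prop) (by fun_prop))
    fun f g k => by rw [← map_add, ← ι_mul, ← ι_mul, ← ι_mul, ← map_add, add_mul]
  zero_mul a := ν.induction_on (p := fun a => 0 * a = 0) a
    (isClosed_eq (by fun_prop) (by fun_prop))
    fun f => by rw [← map_zero ν.ι, ← ι_mul, zero_mul]
  mul_zero a := ν.induction_on (p := fun a => a * 0 = 0) a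
    (isClosed_eq (by fun_prop) (by fun_prop))
    fun f => by rw [← map_zero ν.ι, ← ι_mul, mul_zero]
  mul_assoc a b c := ν.induction_on₃ (p := fun a b c => a * b * c = a * (b * c)) a b c
    (isClosed_eq (by fun_prop) (by fun_prop))
    fun f g k => by rw [← ι_mul, ← ι_mul, ← ι_mul, ← ι_mul, _root_.mul_assoc]
  norm_mul_le a b := ν.induction_on₂ (p := fun a b => ‖a * b‖ ≤ ‖a‖ * ‖b‖) a b
    (isClosed_le (by fun_prop) (by fun_prop))
    fun f g => by
      rw [← ι_mul, norm_ι, norm_ι, norm_ι]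
      exact ν.mul_le' f g

noncomputable instance : Star ν.Completion where
  star := UniformSpace.Completion.map (star : ν.Normed → ν.Normed)

theorem ι_star (f : A) : ν.ι (star f) = star (ν.ι f) :=
  (UniformSpace.Completion.map_coe (α := ν.Normed) (β := ν.Normed)
    (star_isometry (E := ν.Normed)).uniformContinuous f).symm

instance : ContinuousStar ν.Completion where
  continuous_star := UniformSpace.Completion.continuous_map (α := ν.Normed) (β := ν.Normed)

noncomputable instance : StarRing ν.Completion where
  star_involutive a := ν.induction_on (p := fun a => star (star a) = a) a
    (isClosed_eq (by fun_prop) (by fun_prop))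
    fun f => by rw [← ι_star, ← ι_star, star_star]
  star_mul a b := ν.induction_on₂ (p := fun a b => star (a * b) = star b * star a) a b
    (isClosed_eq (by fun_prop) (by fun_prop))
    fun f g => by rw [← ι_mul, ← ι_star, ← ι_star, ← ι_star, ← ι_mul, star_mul]
  star_add a b := ν.induction_on₂ (p := fun a b => star (a + b) = star a + star b) a b
    (isClosed_eq (by fun_prop) (by fun_prop))
    fun f g => by rw [← map_add, ← ι_star, ← ι_star, ← ι_star, ← map_add, star_add]

instance : CStarRing ν.Completion where
  norm_mul_self_le a := ν.induction_on (p := fun a => ‖a‖ * ‖a‖ ≤ ‖star a * a‖) a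
    (isClosed_le (by fun_prop) (by fun_prop))
    fun f => by
      rw [← ι_star, ← ι_mul, norm_ι, norm_ι]
      exact (ν.star_mul_self' f).ge

theorem smul_mul_completion [IsScalarTower ℂ A A] (k : ℂ) (a b : ν.Completion) :
    (k • a) * b = k • (a * b) :=
  ν.induction_on₂ (p := fun a b => (k • a) * b = k • (a * b)) a b
    (isClosed_eq (((continuous_const_smul k).comp continuous_fst).mul continuous_snd)
      ((continuous_const_smul k).comp continuous_mul))
    fun f g => by rw [← ν.ι.map_smul, ← ι_mul, ← ι_mul, ← ν.ι.map_smul, smul_mul_assoc]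

theorem mul_smul_completion [SMulCommClass ℂ A A] (k : ℂ) (a b : ν.Completion) :
    a * (k • b) = k • (a * b) :=
  ν.induction_on₂ (p := fun a b => a * (k • b) = k • (a * b)) a b
    (isClosed_eq (continuous_fst.mul ((continuous_const_smul k).comp continuous_snd))
      ((continuous_const_smul k).comp continuous_mul))
    fun f g => by rw [← ν.ι.map_smul, ← ι_mul, ← ι_mul, ← ν.ι.map_smul, mul_smul_comm]

theorem star_smul_completion [StarModule ℂ A] (k : ℂ) (a : ν.Completion) :
    star (k • a) = star k • star a :=
  ν.induction_on (p := fun a => star (k • a) = star k • star a) a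
    (isClosed_eq (continuous_star.comp (continuous_const_smul k))
      ((continuous_const_smul (star k)).comp continuous_star))
    fun f => by rw [← ν.ι.map_smul, ← ι_star, ← ι_star, ← ν.ι.map_smul, star_smul]

instance [IsScalarTower ℂ A A] : IsScalarTower ℂ ν.Completion ν.Completion :=
  ⟨ν.smul_mul_completion⟩

instance [SMulCommClass ℂ A A] : SMulCommClass ℂ ν.Completion ν.Completion :=
  ⟨fun k a b => (ν.mul_smul_completion k a b).symm⟩

instance [StarModule ℂ A] : StarModule ℂ ν.Completion := ⟨ν.star_smul_completion⟩

noncomputable instance [IsScalarTower ℂ A A] [SMulCommClass ℂ A A] [StarModule ℂ A] :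
    NonUnitalCStarAlgebra ν.Completion where

end CStarNorm

end Completion

section Reduced

variable {G : Type*} [ArrowGroupoid G]

/-- The Hilbert space `ℓ²(G_x)`. -/
abbrev FiberL2 (x : UnitSpace G) : Type _ := lp (fun _ : Fiber x => ℂ) 2

/-- The vector `δ_x ∈ ℓ²(G_x)`. -/
noncomputable def deltaUnit (x : UnitSpace G) : FiberL2 x :=
  letI := Classical.decEq (Fiber x)
  lp.single 2 ⟨x, s_unit x⟩ 1

theorem deltaUnit_eq (x : UnitSpace G) [DecidableEq (Fiber x)] :
    deltaUnit x = lp.single 2 (⟨x, s_unit x⟩ : Fiber x) (1 : ℂ) := by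
  unfold deltaUnit
  congr!

theorem norm_deltaUnit (x : UnitSpace G) : ‖deltaUnit x‖ = 1 := by
  classical
  rw [deltaUnit_eq, lp.norm_single (by norm_num), norm_one]

theorem inner_deltaUnit (x : UnitSpace G) (ξ : FiberL2 x) :
    inner ℂ (deltaUnit x) ξ = ξ ⟨x, s_unit x⟩ := by
  classical
  rw [deltaUnit_eq, lp.inner_single_left]
  simp

variable [TopologicalSpace G] [IsEtaleGroupoid G]

theorem fiberOp_bound (f : ConvAlg G) : ∃ C : ℝ, 0 ≤ C ∧ ∀ (x : UnitSpace G) (ξ : FiberL2 x)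
    (T : Finset (Fiber x)), ∑ c ∈ T, ‖fiberOp f x ξ c‖ ^ 2 ≤ (C * ‖ξ‖) ^ 2 := by
  classical
  obtain ⟨C₁, hC₁, h₁⟩ := exists_sum_norm_le IsEtaleGroupoid.isLocalHomeomorph_r
    (show C_c(G, ℂ) from f)
  obtain ⟨C₂, hC₂, h₂⟩ := exists_sum_norm_le isLocalHomeomorph_s (show C_c(G, ℂ) from f)
  refine ⟨C₁ + C₂, by positivity, fun x ξ T => ?_⟩
  have hrow : ∀ (c : Fiber x) (D : Finset (Fiber x)), ∑ a ∈ D, ‖f (div c a)‖ ≤ C₁ := by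
    intro c D
    have hinj : Set.InjOn (fun a : Fiber x => div (c : G) a) D := by
      intro a _ b _ hab
      have ha : s (c : G) = s (a : G) := c.2.trans a.2.symm
      have hb : s (c : G) = s (b : G) := c.2.trans b.2.symm
      have h := congrArg inv hab
      simp only [inv_div ha, inv_div hb] at h
      exact Subtype.ext (by rw [← div_mul_cancel' ha.symm, h, div_mul_cancel' hb.symm])
    rw [← Finset.sum_image (f := fun a : G => ‖f a‖) hinj]
    refine h₁ (r (c : G)) _ fun a ha => ?_
    obtain ⟨b, -, rfl⟩ := Finset.mem_image.1 ha
    exact r_div (c.2.trans b.2.symm)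
  have hcol : ∀ (a : Fiber x) (D : Finset (Fiber x)), ∑ c ∈ D, ‖f (div c a)‖ ≤ C₂ := by
    intro a D
    have hinj : Set.InjOn (fun c : Fiber x => div (c : G) a) D := by
      intro b _ c _ hbc
      have hb : s (b : G) = s (a : G) := b.2.trans a.2.symm
      have hc : s (c : G) = s (a : G) := c.2.trans a.2.symm
      simp only at hbc
      exact Subtype.ext (by rw [← div_mul_cancel' hb, hbc, div_mul_cancel' hc])
    rw [← Finset.sum_image (f := fun a : G => ‖f a‖) hinj]
    refine h₂ (r (a : G)) _ fun c hc => ?_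
    obtain ⟨b, -, rfl⟩ := Finset.mem_image.1 hc
    exact s_div (b.2.trans a.2.symm)
  let D : Fiber x → Finset (Fiber x) := fun c => (f.rFinite.finite_div c).toFinset
  let A : Finset (Fiber x) := T.biUnion D
  have hpt : ∀ c ∈ T, ‖fiberOp f x ξ c‖ ^ 2 ≤ C₁ * ∑ a ∈ A, ‖f (div c a)‖ * ‖ξ a‖ ^ 2 := by
    intro c hc
    have e : fiberOp f x ξ c = ∑ a ∈ A, f (div c a) * ξ a := by
      refine finsum_eq_sum_of_support_subset _ fun a ha => ?_
      refine Finset.mem_coe.2 (Finset.mem_biUnion.2 ⟨c, hc, ?_⟩)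
      simp only [D, Set.Finite.mem_toFinset, Set.mem_ofPred_eq]
      exact left_ne_zero_of_mul ha
    calc ‖fiberOp f x ξ c‖ ^ 2 ≤ (∑ a ∈ A, ‖f (div c a)‖ * ‖ξ a‖) ^ 2 := by
          rw [e]
          gcongr
          refine (norm_sum_le _ _).trans (le_of_eq ?_)
          simp only [norm_mul]
      _ ≤ (∑ a ∈ A, ‖f (div c a)‖) * ∑ a ∈ A, ‖f (div c a)‖ * ‖ξ a‖ ^ 2 :=
          Finset.sum_sq_le_sum_mul_sum_of_sq_le_mul _ (fun a _ => norm_nonneg _)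
            (fun a _ => by positivity) (fun a _ => le_of_eq (by ring))
      _ ≤ C₁ * ∑ a ∈ A, ‖f (div c a)‖ * ‖ξ a‖ ^ 2 := by
          gcongr
          exact hrow c A
  have hξ : ∑ a ∈ A, ‖ξ a‖ ^ 2 ≤ ‖ξ‖ ^ 2 := by
    have := lp.sum_rpow_le_norm_rpow (p := 2) (by norm_num) ξ A
    simpa using this
  calc ∑ c ∈ T, ‖fiberOp f x ξ c‖ ^ 2
      ≤ ∑ c ∈ T, C₁ * ∑ a ∈ A, ‖f (div c a)‖ * ‖ξ a‖ ^ 2 := Finset.sum_le_sum hpt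
    _ = C₁ * ∑ a ∈ A, (∑ c ∈ T, ‖f (div c a)‖) * ‖ξ a‖ ^ 2 := by
        rw [← Finset.mul_sum, Finset.sum_comm]
        simp only [Finset.sum_mul]
    _ ≤ C₁ * ∑ a ∈ A, C₂ * ‖ξ a‖ ^ 2 := by
        gcongr with a _
        exact hcol a T
    _ ≤ C₁ * (C₂ * ‖ξ‖ ^ 2) := by
        rw [← Finset.mul_sum]
        gcongr
    _ ≤ ((C₁ + C₂) * ‖ξ‖) ^ 2 := by
        have : C₁ * C₂ ≤ (C₁ + C₂) ^ 2 := by nlinarith [sq_nonneg C₁, sq_nonneg C₂, mul_nonneg hC₁ hC₂]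
        nlinarith [mul_le_mul_of_nonneg_right this (sq_nonneg ‖ξ‖)]

theorem memℓp_fiberOp (f : ConvAlg G) (x : UnitSpace G) (ξ : FiberL2 x) :
    Memℓp (fiberOp f x ξ) 2 := by
  obtain ⟨C, -, h⟩ := fiberOp_bound f
  refine memℓp_gen' (C := (C * ‖ξ‖) ^ 2) fun T => ?_
  simpa using h x ξ T

/-- The operator `λ_x(f)` on `ℓ²(G_x)`, as a linear map. -/
noncomputable def regularLin (f : ConvAlg G) (x : UnitSpace G) : FiberL2 x →ₗ[ℂ] FiberL2 x where
  toFun ξ := ⟨fiberOp f x ξ, memℓp_fiberOp f x ξ⟩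
  map_add' ξ η := Subtype.ext (fiberOp_add_right f.rFinite ξ η)
  map_smul' k ξ := Subtype.ext (fiberOp_smul_right k f ξ)

theorem exists_regularLin_bound (f : ConvAlg G) : ∃ C : ℝ, 0 ≤ C ∧ ∀ (x : UnitSpace G)
    (ξ : FiberL2 x), ‖regularLin f x ξ‖ ≤ C * ‖ξ‖ := by
  obtain ⟨C, hC, h⟩ := fiberOp_bound f
  refine ⟨C, hC, fun x ξ => ?_⟩
  refine lp.norm_le_of_forall_sum_le (p := 2) (by norm_num) (by positivity) fun T => ?_
  have := h x ξ T
  simp only [ENNReal.toReal_ofNat, Real.rpow_ofNat]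
  exact this

/-- The bounded operator `λ_x(f)` on `ℓ²(G_x)`. -/
noncomputable def regularOp (f : ConvAlg G) (x : UnitSpace G) : FiberL2 x →L[ℂ] FiberL2 x :=
  (regularLin f x).mkContinuousOfExistsBound
    ((exists_regularLin_bound f).imp fun _ h => h.2 x)

theorem regularOp_apply (f : ConvAlg G) (x : UnitSpace G) (ξ : FiberL2 x) (c : Fiber x) :
    regularOp f x ξ c = ∑ᶠ a : Fiber x, f (div c a) * ξ a := rfl

theorem regularOp_single [DecidableEq G] (f : ConvAlg G) (x : UnitSpace G) (a c : Fiber x) :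
    regularOp f x (lp.single 2 a 1) c = f (div c a) := by
  rw [regularOp_apply, finsum_eq_single _ a, lp.single_apply_self, mul_one]
  intro b hb
  rw [lp.single_apply_ne _ _ _ hb, mul_zero]

theorem regularOp_deltaUnit (f : ConvAlg G) (x : UnitSpace G) (c : Fiber x) :
    regularOp f x (deltaUnit x) c = f c := by
  classical
  rw [deltaUnit_eq, regularOp_single, div_unit c.2]

theorem norm_regularOp_le (f : ConvAlg G) : ∃ C : ℝ, ∀ x, ‖regularOp f x‖ ≤ C := by
  obtain ⟨C, hC, h⟩ := exists_regularLin_bound f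
  exact ⟨C, fun x => ContinuousLinearMap.opNorm_le_bound _ hC (h x)⟩

theorem regularOp_star (f : ConvAlg G) (x : UnitSpace G) :
    regularOp (star f) x = star (regularOp f x) := by
  classical
  rw [ContinuousLinearMap.star_eq_adjoint]
  ext ξ c
  have h1 : (ContinuousLinearMap.adjoint (regularOp f x) ξ) c =
      inner ℂ (lp.single 2 c (1 : ℂ)) (ContinuousLinearMap.adjoint (regularOp f x) ξ) := by
    rw [lp.inner_single_left]
    simp
  rw [h1, ContinuousLinearMap.adjoint_inner_right, lp.inner_eq_tsum, regularOp_apply]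
  have h2 : ∀ a : Fiber x, inner ℂ (regularOp f x (lp.single 2 c (1 : ℂ)) a) (ξ a) =
      (star f) (div c a) * ξ a := by
    intro a
    rw [regularOp_single, ConvAlg.coe_star, involution, inv_div (c.2.trans a.2.symm)]
    simp [mul_comm]
  simp only [h2]
  rw [tsum_eq_finsum]
  exact finite_fiberOp (star f).rFinite ξ c

variable [T2Space G] [LocallyCompactSpace G]

/-- The left regular representation `λ_x : C_c(G) → B(ℓ²(G_x))`, a `*`-homomorphism. -/
noncomputable def leftRegular (x : UnitSpace G) :
    ConvAlg G →⋆ₙₐ[ℂ] (FiberL2 x →L[ℂ] FiberL2 x) where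
  toFun f := regularOp f x
  map_smul' k f := by
    ext ξ c
    exact congrFun (fiberOp_smul_left k f (ξ : Fiber x → ℂ)) c
  map_zero' := by
    ext ξ c
    change regularOp 0 x ξ c = 0
    simp [regularOp_apply, ConvAlg.coe_zero]
  map_add' f g := by
    ext ξ c
    exact congrFun (fiberOp_add_left f.rFinite g.rFinite (ξ : Fiber x → ℂ)) c
  map_mul' f g := by
    ext ξ c
    exact congrFun (fiberOp_conv f.rFinite g.rFinite x (ξ : Fiber x → ℂ)) c
  map_star' f := regularOp_star f x

theorem bddAbove_norm_leftRegular (f : ConvAlg G) :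
    BddAbove (Set.range fun x : UnitSpace G => ‖leftRegular x f‖) := by
  obtain ⟨C, hC⟩ := norm_regularOp_le f
  exact ⟨C, by rintro _ ⟨x, rfl⟩; exact hC x⟩

theorem norm_leftRegular_le_iSup (f : ConvAlg G) (x : UnitSpace G) :
    ‖leftRegular x f‖ ≤ ⨆ y : UnitSpace G, ‖leftRegular y f‖ :=
  le_ciSup (bddAbove_norm_leftRegular f) x

theorem norm_apply_le_norm_leftRegular (f : ConvAlg G) (a : G) :
    ‖f a‖ ≤ ‖leftRegular (s a) f‖ := by
  have h1 := lp.norm_apply_le_norm (p := 2) (by norm_num)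
    (regularOp f (s a) (deltaUnit (s a))) ⟨a, rfl⟩
  rw [regularOp_deltaUnit] at h1
  have h2 := (leftRegular (s a) f).le_opNorm (deltaUnit (s a))
  rw [norm_deltaUnit, mul_one] at h2
  exact h1.trans h2

theorem norm_leftRegular_star_mul_self (f : ConvAlg G) (x : UnitSpace G) :
    ‖leftRegular x (star f * f)‖ = ‖leftRegular x f‖ * ‖leftRegular x f‖ := by
  have h : leftRegular x (star f * f) =
      (ContinuousLinearMap.adjoint (regularOp f x)) ∘L (regularOp f x) := by
    rw [← ContinuousLinearMap.star_eq_adjoint, ← regularOp_star]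
    exact map_mul (leftRegular x) (star f) f
  rw [h, ContinuousLinearMap.norm_adjoint_comp_self]
  rfl

theorem iSup_norm_leftRegular_nonneg (f : ConvAlg G) :
    0 ≤ ⨆ x : UnitSpace G, ‖leftRegular x f‖ :=
  Real.iSup_nonneg fun _ => norm_nonneg _

variable (G) in
/-- The reduced C⋆-norm `‖f‖_r = sup_x ‖λ_x(f)‖` on `C_c(G)`. -/
noncomputable def reducedNorm : CStarNorm (ConvAlg G) where
  toFun f := ⨆ x : UnitSpace G, ‖leftRegular x f‖
  map_zero' := by simp
  add_le' f g := by
    have nn := iSup_norm_leftRegular_nonneg (G := G)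
    refine Real.iSup_le (fun x => ?_) (add_nonneg (nn f) (nn g))
    rw [map_add]
    exact (norm_add_le _ _).trans
      (add_le_add (norm_leftRegular_le_iSup f x) (norm_leftRegular_le_iSup g x))
  neg' f := by simp only [map_neg, norm_neg]
  mul_le' f g := by
    have nn := iSup_norm_leftRegular_nonneg (G := G)
    refine Real.iSup_le (fun x => ?_) (mul_nonneg (nn f) (nn g))
    rw [map_mul]
    exact (norm_mul_le _ _).trans (mul_le_mul (norm_leftRegular_le_iSup f x)
      (norm_leftRegular_le_iSup g x) (norm_nonneg _) (nn f))
  eq_zero_of_map_eq_zero' f hf := by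
    ext a
    have h := (norm_apply_le_norm_leftRegular f a).trans (norm_leftRegular_le_iSup f (s a))
    change (⨆ x : UnitSpace G, ‖leftRegular x f‖) = 0 at hf
    rw [hf] at h
    exact norm_le_zero_iff.1 h
  smul' k f := by
    simp only [map_smul, norm_smul]
    exact (Real.mul_iSup_of_nonneg (norm_nonneg k) _).symm
  star_mul_self' f := by
    have nn := iSup_norm_leftRegular_nonneg (G := G)
    have key := norm_leftRegular_star_mul_self f
    refine le_antisymm (Real.iSup_le (fun x => ?_) (mul_nonneg (nn f) (nn f))) ?_
    · rw [key]
      exact mul_le_mul (norm_leftRegular_le_iSup f x) (norm_leftRegular_le_iSup f x)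
        (norm_nonneg _) (nn f)
    · have h : (⨆ x : UnitSpace G, ‖leftRegular x f‖) ≤
          √(⨆ x : UnitSpace G, ‖leftRegular x (star f * f)‖) := by
        refine Real.iSup_le (fun x => Real.le_sqrt_of_sq_le ?_) (Real.sqrt_nonneg _)
        rw [sq, ← key]
        exact norm_leftRegular_le_iSup _ x
      rw [← Real.mul_self_sqrt (nn (star f * f))]
      exact mul_self_le_mul_self (nn f) h

variable (G) in
/-- The reduced groupoid C⋆-algebra. -/
abbrev ReducedCStar : Type _ := (reducedNorm G).Completion

/-- The C⋆-norm `ν` on `C_c(G)` dominates the reduced C⋆-norm. -/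
def DominatesReduced (ν : CStarNorm (ConvAlg G)) : Prop := ∀ f, reducedNorm G f ≤ ν f

/-- The canonical map `q_ν : C⋆_ν(G) → C⋆_r(G)`: the continuous extension of the identity of
`C_c(G)`, which exists when `ν` dominates the reduced norm. -/
noncomputable def quotientMap (ν : CStarNorm (ConvAlg G)) : ν.Completion →L[ℂ] ReducedCStar G :=
  (reducedNorm G).ι.extendOfNorm ν.ι

theorem quotientMap_ι {ν : CStarNorm (ConvAlg G)} (hν : DominatesReduced ν) (f : ConvAlg G) :
    quotientMap ν (ν.ι f) = (reducedNorm G).ι f :=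
  LinearMap.extendOfNorm_eq ν.denseRange_ι
    ⟨1, fun f => by rw [CStarNorm.norm_ι, CStarNorm.norm_ι, one_mul]; exact hν f⟩ f

/-- The extension of the left regular representation `λ_x` to the reduced groupoid
C⋆-algebra. -/
noncomputable def leftRegularExt (x : UnitSpace G) :
    ReducedCStar G →L[ℂ] (FiberL2 x →L[ℂ] FiberL2 x) :=
  (((leftRegular x : ConvAlg G →⋆ₙₐ[ℂ] (FiberL2 x →L[ℂ] FiberL2 x)) :
    ConvAlg G →ₙₐ[ℂ] (FiberL2 x →L[ℂ] FiberL2 x)) :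
      ConvAlg G →ₗ[ℂ] (FiberL2 x →L[ℂ] FiberL2 x)).extendOfNorm (reducedNorm G).ι

theorem leftRegularExt_ι (x : UnitSpace G) (f : ConvAlg G) :
    leftRegularExt x ((reducedNorm G).ι f) = leftRegular x f :=
  LinearMap.extendOfNorm_eq (reducedNorm G).denseRange_ι
    ⟨1, fun f => by
      rw [CStarNorm.norm_ι, one_mul]
      exact norm_leftRegular_le_iSup f x⟩ f

theorem norm_leftRegularExt_le (x : UnitSpace G) (a : ReducedCStar G) :
    ‖leftRegularExt x a‖ ≤ ‖a‖ := by
  have := LinearMap.norm_extendOfNorm_apply_le (reducedNorm G).denseRange_ι 1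
    (f := (((leftRegular x : ConvAlg G →⋆ₙₐ[ℂ] (FiberL2 x →L[ℂ] FiberL2 x)) :
      ConvAlg G →ₙₐ[ℂ] (FiberL2 x →L[ℂ] FiberL2 x)) :
        ConvAlg G →ₗ[ℂ] (FiberL2 x →L[ℂ] FiberL2 x)))
    (fun f => by
      rw [CStarNorm.norm_ι, one_mul]
      exact norm_leftRegular_le_iSup f x) a
  rwa [one_mul] at this

/-- The function `u ↦ ⟨λ_u(a) δ_u, δ_u⟩` on the unit space. -/
noncomputable def diagonal (a : ReducedCStar G) (u : UnitSpace G) : ℂ :=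
  inner ℂ (deltaUnit u) (leftRegularExt u a (deltaUnit u))

theorem diagonal_ι (f : ConvAlg G) (u : UnitSpace G) : diagonal ((reducedNorm G).ι f) u = f u := by
  rw [diagonal, leftRegularExt_ι, inner_deltaUnit]
  exact regularOp_deltaUnit f u ⟨u, s_unit u⟩

theorem norm_diagonal_sub_le (a b : ReducedCStar G) (u : UnitSpace G) :
    ‖diagonal a u - diagonal b u‖ ≤ ‖a - b‖ := by
  rw [diagonal, diagonal, ← inner_sub_right, ← sub_apply, ← map_sub]
  refine (norm_inner_le_norm _ _).trans ?_
  rw [norm_deltaUnit, one_mul]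
  refine ((leftRegularExt u (a - b)).le_opNorm _).trans ?_
  rw [norm_deltaUnit, mul_one]
  exact norm_leftRegularExt_le u _

end Reduced

section Expectation

variable {G : Type*} [TopologicalSpace G] [ArrowGroupoid G] [IsEtaleGroupoid G] [T2Space G]

/-- The inclusion `C_c(G⁽⁰⁾) → C_c(G)`, extending a function by zero outside of the unit space. -/
noncomputable def extendByZero (f : C_c(UnitSpace G, ℂ)) : ConvAlg G :=
  (⟨⟨Function.extend Subtype.val f 0, by
      rw [continuous_iff_continuousAt]
      intro a
      by_cases ha : a ∈ unitSet G
      · have h := isOpen_unitSet (G := G) |>.isOpenEmbedding_subtypeVal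
        rw [show a = ((⟨a, ha⟩ : UnitSpace G) : G) from rfl, ← h.continuousAt_iff,
          Function.extend_comp Subtype.val_injective]
        exact f.continuous.continuousAt
      · refine (continuousAt_const (y := (0 : ℂ))).congr ?_
        filter_upwards [(isClosed_unitSet (G := G)).isOpen_compl.mem_nhds ha] with b hb
        rw [Function.extend_apply' _ _ _ (by rintro ⟨u, rfl⟩; exact hb u.2)]
        rfl⟩,
    HasCompactSupport.of_support_subset_isCompact
      (f.hasCompactSupport.isCompact.image continuous_subtype_val) (by
        intro a ha
        by_cases h : ∃ u : UnitSpace G, (u : G) = a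
        · obtain ⟨u, rfl⟩ := h
          refine ⟨u, subset_tsupport _ ?_, rfl⟩
          have h1 : Function.extend Subtype.val f 0 (u : G) ≠ 0 := ha
          rwa [Subtype.val_injective.extend_apply] at h1
        · exact absurd (Function.extend_apply' _ _ _ h) ha)⟩ : C_c(G, ℂ))

theorem extendByZero_apply (f : C_c(UnitSpace G, ℂ)) (u : UnitSpace G) :
    extendByZero f (u : G) = f u :=
  Subtype.val_injective.extend_apply _ _ _

theorem extendByZero_apply_of_notMem (f : C_c(UnitSpace G, ℂ)) {a : G} (ha : a ∉ unitSet G) :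
    extendByZero f a = 0 :=
  Function.extend_apply' _ _ _ (by rintro ⟨u, rfl⟩; exact ha u.2)

variable [LocallyCompactSpace G]

/-- The canonical conditional expectation `E : C⋆_r(G) → C₀(G⁽⁰⁾)`,
`E(a)(u) = ⟨λ_u(a) δ_u, δ_u⟩`. -/
noncomputable def expectation (a : ReducedCStar G) : C₀(UnitSpace G, ℂ) where
  toFun := diagonal a
  continuous_toFun := by
    refine continuous_of_uniform_approx_of_continuous fun v hv => ?_
    obtain ⟨ε, hε, hεv⟩ := Metric.mem_uniformity_dist.1 hv
    obtain ⟨f, hf⟩ := (reducedNorm G).denseRange_ι.exists_dist_lt a hε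
    refine ⟨fun u => f u, (show C_c(G, ℂ) from f).continuous.comp continuous_subtype_val,
      fun u => hεv ?_⟩
    change dist (diagonal a u) (f (u : G)) < ε
    rw [← diagonal_ι f u, dist_eq_norm]
    rw [dist_eq_norm] at hf
    exact (norm_diagonal_sub_le _ _ u).trans_lt hf
  zero_at_infty' := by
    rw [Metric.tendsto_nhds]
    intro ε hε
    obtain ⟨f, hf⟩ := (reducedNorm G).denseRange_ι.exists_dist_lt a hε
    have hK : IsCompact ((Subtype.val : UnitSpace G → G) ⁻¹' tsupport (show C_c(G, ℂ) from f)) :=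
      (isClosed_unitSet (G := G)).isClosedEmbedding_subtypeVal.isCompact_preimage
        (show C_c(G, ℂ) from f).hasCompactSupport.isCompact
    filter_upwards [hK.compl_mem_cocompact] with u hu
    have h0 : f (u : G) = 0 := image_eq_zero_of_notMem_tsupport (f := (show C_c(G, ℂ) from f)) hu
    have h := norm_diagonal_sub_le a ((reducedNorm G).ι f) u
    rw [diagonal_ι, h0, sub_zero] at h
    rw [dist_eq_norm, sub_zero]
    rw [dist_eq_norm] at hf
    exact h.trans_lt hf

theorem expectation_ι (f : ConvAlg G) (u : UnitSpace G) :
    expectation ((reducedNorm G).ι f) u = f u := diagonal_ι f u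

end Expectation

section Traces

/-- A tracial state on a C⋆-algebra: a positive linear functional of norm one such that
`τ(ab) = τ(ba)`. -/
structure IsTracialState {A : Type*} [NonUnitalCStarAlgebra A] (τ : A →L[ℂ] ℂ) : Prop where
  nonneg : ∀ a, 0 ≤ τ (star a * a)
  norm_eq_one : ‖τ‖ = 1
  map_mul_comm : ∀ a b, τ (a * b) = τ (b * a)

variable {G : Type*} [TopologicalSpace G] [ArrowGroupoid G]

/-- A bisection: a set on which the source and the range map are homeomorphisms onto their
images. -/
def IsBisection (B : Set G) : Prop :=
  IsEmbedding (B.domRestrict (s : G → UnitSpace G)) ∧ IsEmbedding (B.domRestrict (r : G → UnitSpace G))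

/-- The map `α_B : s(B) → r(B) ⊆ G⁽⁰⁾`, sending `x` to the range of the element of `B` with source `x`; this
element is unique if `B` is a bisection. -/
noncomputable def bisectionMap (B : Set G) (x : (s : G → UnitSpace G) '' B) : UnitSpace G :=
  r x.2.choose

/-- The fixed point set `Fix(α_B) = {x ∈ s(B) : α_B(x) = x}`. -/
def fixSet (B : Set G) : Set (UnitSpace G) :=
  {x | ∃ hx : x ∈ (s : G → UnitSpace G) '' B, bisectionMap B ⟨x, hx⟩ = x}

/-- `G` is essentially free with respect to `μ`: `μ(Fix(α_B)) = 0` for all pre-compact open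
bisections `B ⊆ G \ G⁽⁰⁾`. -/
def EssentiallyFree [MeasurableSpace (UnitSpace G)] (μ : Measure (UnitSpace G)) : Prop :=
  ∀ B : Set G, IsOpen B → IsBisection B → IsCompact (closure B) → B ⊆ (unitSet G)ᶜ →
    μ (fixSet B) = 0

variable [IsEtaleGroupoid G] [T2Space G] [LocallyCompactSpace G]

/-- The measure on `G⁽⁰⁾` associated to the functional `τ` on `C⋆_ν(G)`: the probability Radon measure
representing the restriction of `τ` to `C_c(G⁽⁰⁾)`, hence, by density, to `C₀(G⁽⁰⁾)`. -/
structure IsAssociatedMeasure (ν : CStarNorm (ConvAlg G)) (τ : ν.Completion →L[ℂ] ℂ)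
    [MeasurableSpace (UnitSpace G)] (μ : Measure (UnitSpace G)) : Prop where
  isProbabilityMeasure : IsProbabilityMeasure μ
  regular : μ.Regular
  eq_integral : ∀ f : C_c(UnitSpace G, ℂ), τ (ν.ι (extendByZero f)) = ∫ u, f u ∂μ

/-- The functional `τ_μ(a) = ∫ E(q_ν(a)) dμ` on `C⋆_ν(G)`, for a C⋆-norm `ν` which dominates the
reduced norm. -/
noncomputable def traceOfMeasure (ν : CStarNorm (ConvAlg G)) [MeasurableSpace (UnitSpace G)]
    (μ : Measure (UnitSpace G)) (a : ν.Completion) : ℂ :=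
  ∫ u, expectation (quotientMap ν a) u ∂μ

end Traces

end ArrowGroupoid

/-!
The functionals `τ` and `a ↦ ∫ E(q_ν(a)) dμ` are both continuous, so they need only be compared on
`C_c(G)`. As `G⁽⁰⁾` is clopen, `f ∈ C_c(G)` is the sum of a function supported on `G⁽⁰⁾`, where the
two functionals agree by the definition of `μ`, and a function vanishing on `G⁽⁰⁾`. The claim is
thus that `τ` vanishes on the functions `f` of the second kind, for which `∫ f|_{G⁽⁰⁾} dμ = 0`.

If `tsupport f` lies in an open set `V` with `s(V) ∩ r(V) = ∅`, choose `k ∈ C_c(G⁽⁰⁾)` which is `1`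
on `s(tsupport f)` and `0` off `s(V)`. Then `f * k = f` and `k * f = 0`, whence `τ(f) = 0` by the
trace property. A partition of unity extends this to all `f` whose closed support does not meet the
isotropy `{γ | s(γ) = r(γ)}` (`trace_eq_zero_of_disjoint_isotropy`).

In general, let `K` be the set of sources of the isotropy elements of `tsupport f`. It is compact,
and it is covered by finitely many sets `Fix(α_B)`, so it is `μ`-null by essential freeness
(`measure_image_isotropy_eq_zero`). Choose an open `U ⊇ K` of small measure and `h ∈ C_c(G⁽⁰⁾)` with
`|h| ≤ 1`, equal to `1` near `K` and to `0` off `U`. The closed support of `f - f * h` avoids the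
isotropy, so `τ(f) = τ(f * h)`, and by Cauchy–Schwarz
`|τ(f * h)|² ≤ τ(f * f*) ∫ |h|² dμ ≤ τ(f * f*) μ(U)`.
-/

namespace ArrowGroupoid

open Set Filter Topology CompactlySupported ComplexConjugate ComplexOrder MeasureTheory

/-! ### The Cauchy–Schwarz inequality for positive functionals -/

section CauchySchwarz

variable {A : Type*} [NonUnitalCStarAlgebra A]

/-- A functional which is nonnegative on all `a* a` is Hermitian on products; since `A` may lack a
unit, this comes by polarization rather than from the case `b = 1`. -/
theorem conj_apply_star_mul {τ : A →L[ℂ] ℂ} (hτ : ∀ a, 0 ≤ τ (star a * a)) (a b : A) :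
    conj (τ (star b * a)) = τ (star a * b) := by
  have him : ∀ c, (τ (star c * c)).im = 0 := fun c => ((Complex.le_def.1 (hτ c)).2).symm
  have h1 := him (a + b)
  have h2 := him (a + Complex.I • b)
  have ha := him a
  have hb := him b
  simp only [star_add, star_smul, add_mul, mul_add, smul_mul_assoc, mul_smul_comm, map_add,
    map_smul, smul_eq_mul, Complex.add_im, Complex.mul_im, Complex.mul_re,
    Complex.I_re, Complex.I_im, RCLike.star_def, Complex.conj_I, Complex.neg_re,
    Complex.neg_im] at h1 h2
  apply Complex.ext
  · rw [Complex.conj_re]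
    linarith
  · rw [Complex.conj_im]
    linarith

/-- The semi-inner product `⟨a, b⟩ = τ(a* b)` of a positive functional. -/
noncomputable abbrev positiveCore {τ : A →L[ℂ] ℂ} (hτ : ∀ a, 0 ≤ τ (star a * a)) :
    PreInnerProductSpace.Core ℂ A where
  inner a b := τ (star a * b)
  conj_inner_symm a b := conj_apply_star_mul hτ a b
  re_inner_nonneg a := (Complex.le_def.1 (hτ a)).1
  add_left a b c := by simp only [star_add, add_mul, map_add]
  smul_left a b k := by
    simp only [star_smul, smul_mul_assoc, map_smul, smul_eq_mul, RCLike.star_def]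

theorem norm_sq_apply_star_mul_le {τ : A →L[ℂ] ℂ} (hτ : ∀ a, 0 ≤ τ (star a * a)) (a b : A) :
    ‖τ (star a * b)‖ ^ 2 ≤ (τ (star a * a)).re * (τ (star b * b)).re := by
  have h : ‖τ (star a * b)‖ * ‖τ (star b * a)‖ ≤ (τ (star a * a)).re * (τ (star b * b)).re :=
    @InnerProductSpace.Core.inner_mul_inner_self_le ℂ A _ _ _ (positiveCore hτ) a b
  rwa [← conj_apply_star_mul hτ b a, RCLike.norm_conj, ← sq] at h

end CauchySchwarz

/-! ### Convolution with functions on the unit space -/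

section Units

variable {G : Type*} [ArrowGroupoid G]

theorem conv_eq_mul_src (f : G → ℂ) {k : G → ℂ} (hk : ∀ a ∉ unitSet G, k a = 0) (c : G) :
    conv f k c = f c * k (src c) := by
  rw [conv, finsum_eq_single _ (⟨s c, s_unit _⟩ : Fiber (s c))]
  · rw [div_unit rfl]
    rfl
  · intro a ha
    rw [hk a, mul_zero]
    intro hu
    exact ha (Subtype.ext ((show src (a : G) = a from hu).symm.trans (s_eq_iff.1 a.2)))

theorem conv_eq_rng_mul {k : G → ℂ} (hk : ∀ a ∉ unitSet G, k a = 0) (f : G → ℂ) (c : G) :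
    conv k f c = k (rng c) * f c := by
  rw [conv, finsum_eq_single _ (⟨c, rfl⟩ : Fiber (s c))]
  · rw [div, mul_inv_self]
  · intro a ha
    rw [hk (div c a), zero_mul]
    intro hu
    refine ha (Subtype.ext ?_)
    have h1 : src (div c (a : G)) = div c a := hu
    have h2 : src (div c (a : G)) = rng (a : G) := congrArg Subtype.val (s_div a.2.symm)
    have h3 := div_mul_cancel' a.2.symm
    rwa [← h1, h2, rng_mul_self] at h3

variable [TopologicalSpace G] [IsEtaleGroupoid G] [T2Space G]

/-- The restriction map `C_c(G) → C_c(G⁽⁰⁾)`. -/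
noncomputable def restrictUnits (f : ConvAlg G) : C_c(UnitSpace G, ℂ) :=
  ⟨⟨fun u => f u, (show C_c(G, ℂ) from f).continuous.comp continuous_subtype_val⟩,
    (show C_c(G, ℂ) from f).hasCompactSupport.comp_isClosedEmbedding
      (isClosed_unitSet (G := G)).isClosedEmbedding_subtypeVal⟩

theorem extendByZero_restrictUnits {f : ConvAlg G} (hf : ∀ a ∉ unitSet G, f a = 0) :
    extendByZero (restrictUnits f) = f := by
  ext a
  by_cases ha : a ∈ unitSet G
  · exact extendByZero_apply (restrictUnits f) ⟨a, ha⟩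
  · rw [extendByZero_apply_of_notMem _ ha, hf a ha]

variable [LocallyCompactSpace G]

theorem mul_extendByZero_apply (f : ConvAlg G) (h : C_c(UnitSpace G, ℂ)) (c : G) :
    (f * extendByZero h) c = f c * h (s c) := by
  rw [ConvAlg.coe_mul, conv_eq_mul_src f fun a => extendByZero_apply_of_notMem h]
  exact congrArg _ (extendByZero_apply h (s c))

theorem extendByZero_mul_apply (h : C_c(UnitSpace G, ℂ)) (f : ConvAlg G) (c : G) :
    (extendByZero h * f) c = h (r c) * f c := by
  rw [ConvAlg.coe_mul, conv_eq_rng_mul fun a => extendByZero_apply_of_notMem h]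
  exact congrArg (· * f c) (extendByZero_apply h (r c))

instance locallyCompactSpace_unitSpace : LocallyCompactSpace (UnitSpace G) :=
  (isClosed_unitSet (G := G)).isClosedEmbedding_subtypeVal.locallyCompactSpace

theorem exists_unitSpace_bump {K U : Set (UnitSpace G)} (hK : IsCompact K) (hU : IsOpen U)
    (hKU : K ⊆ U) : ∃ h : C_c(UnitSpace G, ℂ), (∀ x ∈ K, h x = 1) ∧ (∀ x ∉ U, h x = 0) ∧
      ∀ x, ‖h x‖ ≤ 1 := by
  obtain ⟨φ, h1, h0, hc, hI⟩ := exists_continuous_one_zero_of_isCompact hK hU.isClosed_compl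
    (disjoint_compl_right_iff_subset.2 hKU)
  refine ⟨⟨⟨fun x => (φ x : ℂ), Complex.continuous_ofReal.comp φ.continuous⟩,
    hc.comp_left (g := fun t : ℝ => (t : ℂ)) Complex.ofReal_zero⟩, ?_, ?_, ?_⟩
  · intro x hx
    change (φ x : ℂ) = 1
    rw [h1 hx, Pi.one_apply, Complex.ofReal_one]
  · intro x hx
    change (φ x : ℂ) = 0
    rw [h0 hx, Pi.zero_apply, Complex.ofReal_zero]
  · intro x
    change ‖(φ x : ℂ)‖ ≤ 1
    rw [Complex.norm_real, Real.norm_of_nonneg (hI x).1]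
    exact (hI x).2

end Units

/-! ### Traces vanish off the isotropy -/

section Isotropy

variable {G : Type*} [TopologicalSpace G]

/-- The pointwise product of a continuous function and a compactly supported one. -/
noncomputable def pointwiseMul (φ : C(G, ℝ)) (f : ConvAlg G) : ConvAlg G :=
  (⟨⟨fun a => (φ a : ℂ) * f a,
    (Complex.continuous_ofReal.comp φ.continuous).mul (show C_c(G, ℂ) from f).continuous⟩,
    (show C_c(G, ℂ) from f).hasCompactSupport.mul_left⟩ : C_c(G, ℂ))

theorem pointwiseMul_apply (φ : C(G, ℝ)) (f : ConvAlg G) (a : G) :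
    pointwiseMul φ f a = (φ a : ℂ) * f a := rfl

variable [ArrowGroupoid G]

variable (G) in
/-- The isotropy of the groupoid: the arrows whose source and range agree. -/
def isotropy : Set G := {a | src a = rng a}

variable [IsEtaleGroupoid G] [T2Space G]

theorem isClosed_isotropy : IsClosed (isotropy G) :=
  isClosed_eq IsEtaleGroupoid.continuous_src IsEtaleGroupoid.continuous_rng

theorem exists_isOpen_disjoint_image {c : G} (hc : c ∉ isotropy G) :
    ∃ V : Set G, IsOpen V ∧ c ∈ V ∧ ∀ a ∈ V, ∀ b ∈ V, src a ≠ rng b := by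
  obtain ⟨P, Q, hP, hQ, hcP, hcQ, hPQ⟩ := t2_separation (show src c ≠ rng c from hc)
  refine ⟨src ⁻¹' P ∩ rng ⁻¹' Q, (hP.preimage IsEtaleGroupoid.continuous_src).inter
    (hQ.preimage IsEtaleGroupoid.continuous_rng), ⟨hcP, hcQ⟩, fun a ha b hb hab => ?_⟩
  exact Set.disjoint_left.1 hPQ ha.1 (show src a ∈ Q from hab ▸ hb.2)

variable [LocallyCompactSpace G] {ν : CStarNorm (ConvAlg G)} {τ : ν.Completion →L[ℂ] ℂ}

theorem trace_eq_zero_of_disjoint_image (hτ : IsTracialState τ) {V : Set G} (hV : IsOpen V)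
    (hsr : ∀ a ∈ V, ∀ b ∈ V, src a ≠ rng b) {f : ConvAlg G} (hf : tsupport f ⊆ V) :
    τ (ν.ι f) = 0 := by
  have hK : IsCompact (s '' tsupport f) :=
    (show C_c(G, ℂ) from f).hasCompactSupport.isCompact.image continuous_s
  obtain ⟨k, hk1, hk0, -⟩ := exists_unitSpace_bump hK
    (isLocalHomeomorph_s.isOpenMap V hV) (image_mono hf)
  have h1 : f * extendByZero k = f := by
    ext c
    rw [mul_extendByZero_apply]
    by_cases hc : f c = 0
    · rw [hc, zero_mul]
    · rw [hk1 _ ⟨c, subset_tsupport _ hc, rfl⟩, mul_one]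
  have h2 : extendByZero k * f = 0 := by
    ext c
    rw [extendByZero_mul_apply]
    by_cases hc : f c = 0
    · rw [hc, mul_zero]
      rfl
    · rw [hk0, zero_mul]
      · rfl
      · rintro ⟨a, ha, hac⟩
        exact hsr a ha c (hf (subset_tsupport _ hc)) (s_eq_r_iff.1 hac)
  rw [← h1, ν.ι_mul, hτ.map_mul_comm, ← ν.ι_mul, h2, map_zero, map_zero]

theorem trace_eq_zero_of_disjoint_isotropy (hτ : IsTracialState τ) {f : ConvAlg G}
    (hf : Disjoint (tsupport f) (isotropy G)) : τ (ν.ι f) = 0 := by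
  have hfc : IsCompact (tsupport f) := (show C_c(G, ℂ) from f).hasCompactSupport.isCompact
  choose! V hV hcV hsr using fun (c : G) (hc : c ∉ isotropy G) => exists_isOpen_disjoint_image hc
  obtain ⟨t, htf, ht⟩ := hfc.elim_nhds_subcover V fun c hc =>
    (hV c (Set.disjoint_left.1 hf hc)).mem_nhds (hcV c (Set.disjoint_left.1 hf hc))
  let q : Fin t.card → G := fun i => t.equivFin.symm i
  have hq : ∀ i, q i ∉ isotropy G := fun i =>
    Set.disjoint_left.1 hf (htf _ (t.equivFin.symm i).2)
  have hcov : tsupport f ⊆ ⋃ i, V (q i) := by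
    intro a ha
    obtain ⟨x, hx, hax⟩ := mem_iUnion₂.1 (ht ha)
    refine mem_iUnion.2 ⟨t.equivFin ⟨x, hx⟩, ?_⟩
    simpa [q] using hax
  obtain ⟨φ, hφs, hφ1, -, -⟩ := exists_continuous_sum_one_of_isOpen_isCompact
    (fun i => hV _ (hq i)) hfc hcov
  have hsum : f = ∑ i, pointwiseMul (φ i) f := by
    let ev (a : G) : ConvAlg G →+ ℂ := ⟨⟨fun g => g a, rfl⟩, fun _ _ => rfl⟩
    ext a
    change ev a f = ev a (∑ i, pointwiseMul (φ i) f)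
    rw [map_sum]
    change f a = ∑ i, (φ i a : ℂ) * f a
    rw [← Finset.sum_mul]
    by_cases ha : a ∈ tsupport f
    · have := hφ1 ha
      simp only [Finset.sum_apply, Pi.one_apply] at this
      rw [← Complex.ofReal_sum, this, Complex.ofReal_one, one_mul]
    · rw [image_eq_zero_of_notMem_tsupport ha, mul_zero]
  rw [hsum, map_sum, map_sum]
  refine Finset.sum_eq_zero fun i _ =>
    trace_eq_zero_of_disjoint_image hτ (hV _ (hq i)) (hsr _ (hq i)) ?_
  have hsupp : Function.support (pointwiseMul (φ i) f) ⊆ Function.support (φ i) := fun a ha h0 =>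
    ha (by rw [pointwiseMul_apply, h0, Complex.ofReal_zero, zero_mul])
  exact (closure_mono hsupp).trans (hφs i)

end Isotropy

/-! ### Essential freeness -/

section Free

variable {G : Type*} [TopologicalSpace G] [ArrowGroupoid G]

theorem IsBisection.mem_fixSet {B : Set G} (hB : IsBisection B) {a : G} (ha : a ∈ B)
    (hi : a ∈ isotropy G) : s a ∈ fixSet B := by
  have hx : ∃ b, b ∈ B ∧ s b = s a := ⟨a, ha, rfl⟩
  have h : (⟨hx.choose, hx.choose_spec.1⟩ : B) = ⟨a, ha⟩ := hB.1.injective hx.choose_spec.2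
  exact ⟨hx, (congrArg r (congrArg Subtype.val h)).trans (s_eq_r_iff.2 hi).symm⟩

theorem IsBisection.mono {B C : Set G} (hB : IsBisection B) (h : C ⊆ B) : IsBisection C :=
  ⟨hB.1.comp (.inclusion h), hB.2.comp (.inclusion h)⟩

variable [IsEtaleGroupoid G]

theorem exists_isBisection_nhds (a : G) : ∃ B : Set G, IsOpen B ∧ a ∈ B ∧ IsBisection B := by
  obtain ⟨e, hae, he⟩ := isLocalHomeomorph_s a
  obtain ⟨e', hae', he'⟩ := IsEtaleGroupoid.isLocalHomeomorph_r a
  have h1 : IsEmbedding (e.source.domRestrict (s : G → UnitSpace G)) := by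
    rw [he]
    exact e.isEmbedding_restrict
  have h2 : IsEmbedding (e'.source.domRestrict (r : G → UnitSpace G)) := by
    rw [he']
    exact e'.isEmbedding_restrict
  exact ⟨e.source ∩ e'.source, e.open_source.inter e'.open_source, ⟨hae, hae'⟩,
    h1.comp (.inclusion inter_subset_left), h2.comp (.inclusion inter_subset_right)⟩

variable [T2Space G] [LocallyCompactSpace G]

theorem exists_precompact_isBisection_nhds {a : G} (ha : a ∉ unitSet G) :
    ∃ B : Set G, IsOpen B ∧ a ∈ B ∧ IsBisection B ∧ IsCompact (closure B) ∧
      B ⊆ (unitSet G)ᶜ := by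
  obtain ⟨B, hBo, haB, hB⟩ := exists_isBisection_nhds a
  obtain ⟨W, hWo, haW, hWB, hWc⟩ := exists_open_between_and_isCompact_closure
    (isCompact_singleton (x := a)) (hBo.inter (isClosed_unitSet (G := G)).isOpen_compl)
    (singleton_subset_iff.2 ⟨haB, ha⟩)
  have hW := subset_closure.trans hWB
  exact ⟨W, hWo, singleton_subset_iff.1 haW, hB.mono (hW.trans inter_subset_left), hWc,
    hW.trans inter_subset_right⟩

theorem measure_image_isotropy_eq_zero [MeasurableSpace (UnitSpace G)] {μ : Measure (UnitSpace G)}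
    (hfree : EssentiallyFree μ) {K : Set G} (hK : IsCompact K) (hKu : K ⊆ (unitSet G)ᶜ) :
    μ (s '' (K ∩ isotropy G)) = 0 := by
  refine hK.induction_on (p := fun S => μ (s '' (S ∩ isotropy G)) = 0) ?_ ?_ ?_ ?_
  · rw [empty_inter, image_empty, measure_empty]
  · intro S T hST hT
    exact measure_mono_null (image_mono (inter_subset_inter_left _ hST)) hT
  · intro S T hS hT
    rw [union_inter_distrib_right, image_union]
    exact measure_union_null hS hT
  · intro a ha
    obtain ⟨B, hBo, haB, hB, hBc, hBu⟩ := exists_precompact_isBisection_nhds (hKu ha)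
    refine ⟨B, mem_nhdsWithin_of_mem_nhds (hBo.mem_nhds haB),
      measure_mono_null ?_ (hfree B hBo hB hBc hBu)⟩
    rintro _ ⟨b, ⟨hb, hbi⟩, rfl⟩
    exact hB.mem_fixSet hb hbi

end Free

/-! ### Comparison with the canonical trace -/

section Canonical

variable {G : Type*} [TopologicalSpace G] [ArrowGroupoid G] [IsEtaleGroupoid G] [T2Space G]
  [LocallyCompactSpace G] [MeasurableSpace (UnitSpace G)] {ν : CStarNorm (ConvAlg G)}
  {τ : ν.Completion →L[ℂ] ℂ} {μ : Measure (UnitSpace G)}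

theorem IsAssociatedMeasure.apply_eq_integral (hμ : IsAssociatedMeasure ν τ μ) {f : ConvAlg G}
    (hf : ∀ a ∉ unitSet G, f a = 0) : τ (ν.ι f) = ∫ u : UnitSpace G, f u ∂μ := by
  rw [← extendByZero_restrictUnits hf, hμ.eq_integral, extendByZero_restrictUnits hf]
  rfl

theorem traceOfMeasure_ι (hν : DominatesReduced ν) (f : ConvAlg G) :
    traceOfMeasure ν μ (ν.ι f) = ∫ u : UnitSpace G, f u ∂μ := by
  simp only [traceOfMeasure, quotientMap_ι hν, expectation_ι]

variable [BorelSpace (UnitSpace G)]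

theorem IsAssociatedMeasure.re_star_mul_self_le (hμ : IsAssociatedMeasure ν τ μ)
    {h : C_c(UnitSpace G, ℂ)} {U : Set (UnitSpace G)} (hU : IsOpen U) (h0 : ∀ x ∉ U, h x = 0)
    (h1 : ∀ x, ‖h x‖ ≤ 1) :
    (τ (star (ν.ι (extendByZero h)) * ν.ι (extendByZero h))).re ≤ μ.real U := by
  have := hμ.isProbabilityMeasure
  have hstar : ∀ c : G, (star (extendByZero h)) c = conj (extendByZero h (inv c)) := fun _ => rfl
  have hval : ∀ u : UnitSpace G, (star (extendByZero h) * extendByZero h) u =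
      conj (h u) * h u := by
    intro u
    rw [mul_extendByZero_apply, hstar, inv_unit u.2, extendByZero_apply, s_unit]
  have hoff : ∀ a ∉ unitSet G, (star (extendByZero h) * extendByZero h) a = 0 := by
    intro a ha
    rw [mul_extendByZero_apply, hstar, extendByZero_apply_of_notMem, map_zero, zero_mul]
    intro hi
    apply ha
    have := inv_unit hi
    rw [inv_inv] at this
    rwa [this]
  rw [← ν.ι_star, ← ν.ι_mul, hμ.apply_eq_integral hoff]
  calc (∫ u : UnitSpace G, (star (extendByZero h) * extendByZero h) u ∂μ).re
      ≤ ‖∫ u : UnitSpace G, (star (extendByZero h) * extendByZero h) u ∂μ‖ := Complex.re_le_norm _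
    _ ≤ ∫ u, U.indicator (fun _ => (1 : ℝ)) u ∂μ := by
        refine norm_integral_le_of_norm_le
          ((integrable_const (1 : ℝ)).indicator hU.measurableSet) (.of_forall fun u => ?_)
        rw [hval, norm_mul, RCLike.norm_conj]
        by_cases hu : u ∈ U
        · rw [indicator_of_mem hu]
          exact mul_le_one₀ (h1 u) (norm_nonneg _) (h1 u)
        · rw [h0 u hu, norm_zero, mul_zero, indicator_of_notMem hu]
    _ = μ.real U := by rw [integral_indicator_const _ hU.measurableSet, smul_eq_mul, mul_one]

theorem trace_eq_zero_of_essentiallyFree (hτ : IsTracialState τ) (hμ : IsAssociatedMeasure ν τ μ)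
    (hfree : EssentiallyFree μ) {f : ConvAlg G} (hf : ∀ a ∈ unitSet G, f a = 0) :
    τ (ν.ι f) = 0 := by
  have := hμ.isProbabilityMeasure
  have := hμ.regular
  have hfc : IsCompact (tsupport f) := (show C_c(G, ℂ) from f).hasCompactSupport.isCompact
  -- The unit space is open, so it is disjoint from the closed support as well.
  have hfu : tsupport f ⊆ (unitSet G)ᶜ :=
    closure_minimal (fun a ha hu => ha (hf a hu)) isOpen_unitSet.isClosed_compl
  have hKc : IsCompact (s '' (tsupport f ∩ isotropy G)) :=
    (hfc.inter_right isClosed_isotropy).image continuous_s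
  have hK0 := measure_image_isotropy_eq_zero hfree hfc hfu
  set C : ℝ := (τ (ν.ι f * star (ν.ι f))).re
  have hC : 0 ≤ C := by
    have h := (Complex.le_def.1 (hτ.nonneg (star (ν.ι f)))).1
    rwa [star_star] at h
  have key : ∀ ε : ℝ, 0 < ε → ‖τ (ν.ι f)‖ ^ 2 ≤ C * ε := by
    intro ε hε
    obtain ⟨U, hKU, hUo, hUε⟩ := (s '' (tsupport f ∩ isotropy G)).exists_isOpen_lt_of_lt
      (μ := μ) (ENNReal.ofReal ε) (by rw [hK0]; exact ENNReal.ofReal_pos.2 hε)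
    obtain ⟨W, hWo, hKW, hWU, hWc⟩ := exists_open_between_and_isCompact_closure hKc hUo hKU
    obtain ⟨h, h1, h0, hle⟩ := exists_unitSpace_bump hWc hUo hWU
    have hrest : τ (ν.ι (f - f * extendByZero h)) = 0 := by
      refine trace_eq_zero_of_disjoint_isotropy hτ ?_
      have hval : ∀ c, (f - f * extendByZero h) c = f c - f c * h (s c) := fun c => by
        rw [← mul_extendByZero_apply, sub_eq_add_neg, ConvAlg.coe_add, ConvAlg.coe_neg]
        exact (sub_eq_add_neg _ _).symm
      have hsub : tsupport (f - f * extendByZero h) ⊆ tsupport f ∩ (s ⁻¹' W)ᶜ := by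
        refine closure_minimal (fun c hc => ?_)
          ((isClosed_tsupport _).inter (hWo.preimage continuous_s).isClosed_compl)
        rw [Function.mem_support, hval] at hc
        refine ⟨subset_tsupport _ fun h0 => hc (by rw [h0, zero_mul, sub_zero]), fun hW => hc ?_⟩
        rw [h1 _ (subset_closure hW), mul_one, sub_self]
      exact Set.disjoint_left.2 fun c hc hi => (hsub hc).2 (hKW ⟨c, ⟨(hsub hc).1, hi⟩, rfl⟩)
    have heq : τ (ν.ι f) = τ (star (star (ν.ι f)) * ν.ι (extendByZero h)) := by
      rw [star_star, ← ν.ι_mul, ← sub_eq_zero, ← map_sub, ← map_sub, hrest]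
    rw [heq]
    refine (norm_sq_apply_star_mul_le hτ.nonneg _ _).trans ?_
    rw [star_star]
    refine mul_le_mul_of_nonneg_left ((hμ.re_star_mul_self_le hUo h0 hle).trans ?_) hC
    exact ENNReal.toReal_le_of_le_ofReal hε.le hUε.le
  have hle : ‖τ (ν.ι f)‖ ^ 2 ≤ 0 := by
    refine le_of_forall_pos_le_add fun δ hδ => ?_
    refine (key (δ / (C + 1)) (by positivity)).trans ?_
    rw [zero_add, ← mul_div_assoc, div_le_iff₀ (by positivity)]
    nlinarith
  exact norm_eq_zero.1 (pow_eq_zero_iff two_ne_zero |>.1 (le_antisymm hle (sq_nonneg _)))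

theorem continuous_traceOfMeasure [IsProbabilityMeasure μ] :
    Continuous (traceOfMeasure ν μ) := by
  have hint : ∀ a : ReducedCStar G, Integrable (fun u => expectation a u) μ := fun a =>
    (BoundedContinuousFunction.integrable μ (expectation a).toBCF)
  have hlip : ∀ a b : ReducedCStar G,
      dist (∫ u, expectation a u ∂μ) (∫ u, expectation b u ∂μ) ≤ dist a b := by
    intro a b
    rw [dist_eq_norm, dist_eq_norm, ← integral_sub (hint a) (hint b)]
    have h := norm_integral_le_of_norm_le_const (μ := μ) (C := ‖a - b‖)
      (f := fun u => expectation a u - expectation b u)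
      (.of_forall fun u => norm_diagonal_sub_le a b u)
    rwa [probReal_univ, mul_one] at h
  exact (LipschitzWith.mk_one hlip).continuous.comp (quotientMap ν).continuous

end Canonical

end ArrowGroupoid

theorem mainTheorem5 {G : Type*} [TopologicalSpace G] [T2Space G] [LocallyCompactSpace G]
    [ArrowGroupoid G] [ArrowGroupoid.IsEtaleGroupoid G]
    [MeasurableSpace (ArrowGroupoid.UnitSpace G)] [BorelSpace (ArrowGroupoid.UnitSpace G)]
    (ν : ArrowGroupoid.CStarNorm (ArrowGroupoid.ConvAlg G))
    (hν : ArrowGroupoid.DominatesReduced ν)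
    (τ : ν.Completion →L[ℂ] ℂ) (hτ : ArrowGroupoid.IsTracialState τ)
    (μ : MeasureTheory.Measure (ArrowGroupoid.UnitSpace G))
    (hμ : ArrowGroupoid.IsAssociatedMeasure ν τ μ)
    (hfree : ArrowGroupoid.EssentiallyFree μ) (a : ν.Completion) :
    τ a = ArrowGroupoid.traceOfMeasure ν μ a := by
  have := hμ.isProbabilityMeasure
  refine ν.induction_on (p := fun a => τ a = ArrowGroupoid.traceOfMeasure ν μ a) a
    (isClosed_eq τ.continuous ArrowGroupoid.continuous_traceOfMeasure) fun f => ?_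
  let d := ArrowGroupoid.extendByZero (ArrowGroupoid.restrictUnits f)
  have hd : ∀ u : ArrowGroupoid.UnitSpace G, d u = f u :=
    ArrowGroupoid.extendByZero_apply (ArrowGroupoid.restrictUnits f)
  have h0 : τ (ν.ι (f - d)) = 0 := by
    refine ArrowGroupoid.trace_eq_zero_of_essentiallyFree hτ hμ hfree fun a ha => ?_
    rw [sub_eq_add_neg, ArrowGroupoid.ConvAlg.coe_add, ArrowGroupoid.ConvAlg.coe_neg]
    exact add_neg_eq_zero.2 (hd ⟨a, ha⟩).symm
  rw [map_sub, map_sub, sub_eq_zero] at h0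
  rw [h0, hμ.eq_integral, ArrowGroupoid.traceOfMeasure_ι hν]
  rfl
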